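/- Let $F$ be a commutative field and let $h,n$ be integers with $0\le h\le n-2$. For $0\le d\le n-1$ let $\Gamma(n,d)$ be the Grassmannian whose points are the $d$-subspaces of the projective space $\mathrm{PG}(n,F)$ (subspaces of projective dimension $d$) and whose lines are the pencils $\{X : \dim X=d,\ U\subseteq X\subseteq W\}$ with $U\subseteq W$, $\dim U=d-1$, $\dim W=d+1$. A partial map $\chi$, with domain $\mathbb D(\chi)$, from the points of $\Gamma(n,d)$ to the points of $\mathrm{PG}(n,F)$ is called a linear mapping if for every line $\ell$ of $\Gamma(n,d)$ one of the following holds: (i) $\ell\subseteq\mathbb D(\chi)$ and $\chi$ maps $\ell$ bijectively onto a line of $\mathrm{PG}(n,F)$; (ii) exactly one element of $\ell$ lies outside $\mathbb D(\chi)$, and all other elements of $\ell$ have the same image; (iii) $\ell\cap\mathbb D(\chi)=\emptyset$. A linear complex of $h$-subspaces is a set $K$ of $h$-subspaces of $\mathrm{PG}(n,F)$ for which there is a hyperplane $H$ of $\mathrm{PG}(N,F)$, $N=\binom{n+1}{h+1}-1$, the projective space on $\bigwedge^{h+1}F^{n+1}$, such that $K$ consists of exactly those $h$-subspaces whose image under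 the Plücker embedding $X\mapsto F(v_0\wedge\dots\wedge v_h)$ ($v_0,\dots,v_h$ a basis of $X$) lies in $H$. The dual polarity ${\downarrow}K$ of a linear complex $K$ of $h$-subspaces is the following partial map from the $(h+1)$-subspaces to the points of $\mathrm{PG}(n,F)$. An $(h+1)$-subspace $V$ is outside its domain if and only if all $h$-subspaces of $V$ belong to $K$; otherwise $V^{{\downarrow}K}$ is the pole of $V$, i.e. the unique point $P\in V$ such that an $h$-subspace $X\subseteq V$ belongs to $K$ if and only if $P\in X$. Theorem. Let $\chi:\Gamma(n,h+1)\to\mathrm{PG}(n,F)$ be a linear mapping with non-empty domain such that $V^\chi\subseteq V$ (i.e. the point $V^\chi$ lies on $V$) for each $V\in\mathbb D(\chi)$. Then there is a unique linear complex $K$ of $h$-subspaces such that $\chi={\downarrow}K$. -/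

import Mathlib

open scoped LinearAlgebra.Projectivization

/-- The vector space `F ^ (n + 1)` underlying the projective space `PG(n, F)`. -/
abbrev Vec (F : Type*) [Field F] (n : ℕ) : Type _ := Fin (n + 1) → F

/-- The set of points of `PG(n, F)`. -/
abbrev PG (n : ℕ) (F : Type*) [Field F] : Type _ := ℙ F (Vec F n)

/-- The `d`-subspaces of `PG(n, F)` (subspaces of projective dimension `d`), that is, the linear
subspaces of `F ^ (n + 1)` of vector space dimension `d + 1`. -/
abbrev ProjFlat (F : Type*) [Field F] (n d : ℕ) : Type _ :=
  {X : Submodule F (Vec F n) // Module.finrank F X = d + 1}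

/-- The lines of `PG(n, F)`, as sets of points. -/
def projLines (F : Type*) [Field F] (n : ℕ) : Set (Set (PG n F)) :=
  {l | ∃ L : ProjFlat F n 1, l = {P | P.submodule ≤ L.1}}

/-- The lines of the Grassmannian `Γ(n, d, F)`, whose points are the `d`-subspaces: the pencils
`[U, W]_d` with `U ⊆ W`, `dim U = d - 1` and `dim W = d + 1` (projective dimensions). -/
def pencils (F : Type*) [Field F] (n d : ℕ) : Set (Set (ProjFlat F n d)) :=
  {l | ∃ U W : Submodule F (Vec F n), U ≤ W ∧ Module.finrank F U = d ∧
    Module.finrank F W = d + 2 ∧ l = {X | U ≤ X.1 ∧ X.1 ≤ W}}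

/-- A partial map `χ` between the point sets of two spaces with line sets `B` and `B'` is a linear
mapping if each line `l` (i) lies in the domain and is mapped bijectively onto a line, or
(ii) contains exactly one exceptional point and has a single image point, or (iii) consists of
exceptional points. -/
def IsLinearMapping {P P' : Type*} (B : Set (Set P)) (B' : Set (Set P')) (χ : P →. P') : Prop :=
  ∀ l ∈ B,
    (χ.image l ∈ B' ∧ l ⊆ χ.Dom ∧ ∀ X ∈ l, ∀ Y ∈ l, ∀ Q, Q ∈ χ X → Q ∈ χ Y → X = Y) ∨
    ((∃ Q, χ.image l = {Q}) ∧ ∃! X, X ∈ l ∩ χ.Domᶜ) ∨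
    l ⊆ χ.Domᶜ

/-- The wedge product of a basis of a subspace is nonzero. -/
theorem wedge_basis_ne_zero {F M : Type*} [Field F] [AddCommGroup M] [Module F M] {k : ℕ}
    {X : Submodule F M} (b : Module.Basis (Fin k) F X) :
    exteriorPower.ιMulti F k (fun i => (b i : M)) ≠ 0 := by
  intro h0
  obtain ⟨g, hg⟩ := X.subtype.exists_leftInverse_of_injective (Submodule.ker_subtype X)
  have h1 := congrArg
    (exteriorPower.alternatingMapLinearEquiv (b.det.compLinearMap g)) h0
  rw [exteriorPower.alternatingMapLinearEquiv_apply_ιMulti, map_zero] at h1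
  have h2 : (fun i => g (b i : M)) = b := by
    funext i
    exact LinearMap.congr_fun hg (b i)
  have h3 : b.det (fun i => g (b i : M)) = 0 := h1
  rw [h2, b.det_self] at h3
  exact one_ne_zero h3

/-- The Plücker embedding `X ↦ F (v₀ ∧ … ∧ v_h)`, where `v₀, …, v_h` is a basis of `X`, of the
`h`-subspaces of `PG(n, F)` into the projective space on the `(h + 1)`-th exterior power. -/
noncomputable def plucker {F : Type*} [Field F] {n h : ℕ} (X : ProjFlat F n h) :
    ℙ F (⋀[F]^(h + 1) (Vec F n)) :=
  Projectivization.mk F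
    (exteriorPower.ιMulti F (h + 1)
      (fun i => (Module.finBasisOfFinrankEq F X.1 X.2 i : Vec F n)))
    (wedge_basis_ne_zero _)

/-- The Plücker point does not depend on the choice of the basis. -/
theorem plucker_eq {F : Type*} [Field F] {n h : ℕ} (X : ProjFlat F n h)
    (b : Module.Basis (Fin (h + 1)) F X.1) :
    plucker X = Projectivization.mk F
      (exteriorPower.ιMulti F (h + 1) (fun i => (b i : Vec F n))) (wedge_basis_ne_zero b) := by
  rw [plucker, Projectivization.mk_eq_mk_iff']
  set c := Module.finBasisOfFinrankEq F X.1 X.2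
  refine ⟨b.det c, ?_⟩
  rw [← sub_eq_zero, ← Module.forall_dual_apply_eq_zero_iff F]
  intro f
  have h1 := AlternatingMap.congr_fun (AlternatingMap.eq_smul_basis_det b
    ((f.compAlternatingMap (exteriorPower.ιMulti F (h + 1))).compLinearMap X.1.subtype)) c
  have h2 : f (exteriorPower.ιMulti F (h + 1) (fun i => (c i : Vec F n))) =
      f (exteriorPower.ιMulti F (h + 1) (fun i => (b i : Vec F n))) * b.det c := h1
  rw [map_sub, map_smul, h2, smul_eq_mul]
  ring

/-- A set of `h`-subspaces of `PG(n, F)` is a linear complex of `h`-subspaces if it is the set of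
all `h`-subspaces whose Plücker point lies in some fixed hyperplane. -/
def IsLinearComplex {F : Type*} [Field F] {n h : ℕ} (K : Set (ProjFlat F n h)) : Prop :=
  ∃ H : Projectivization.Subspace F (⋀[F]^(h + 1) (Vec F n)),
    IsCoatom H ∧ K = {X | plucker X ∈ H}

/-- The type of linear complexes of `h`-subspaces of `PG(n, F)`. -/
abbrev LinearComplex (F : Type*) [Field F] (n h : ℕ) : Type _ :=
  {K : Set (ProjFlat F n h) // IsLinearComplex K}

/-- An `(h + 1)`-subspace `V` is total for a set `K` of `h`-subspaces if all `h`-subspaces of `V`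
belong to `K`. -/
def IsTotalFlat {F : Type*} [Field F] {n h : ℕ} (K : Set (ProjFlat F n h))
    (V : ProjFlat F n (h + 1)) : Prop :=
  ∀ X : ProjFlat F n h, X.1 ≤ V.1 → X ∈ K

/-- A point `P` is a pole of the `(h + 1)`-subspace `V` with respect to `K` if `P` lies in `V` and
an `h`-subspace of `V` belongs to `K` exactly when it contains `P`. -/
def IsPole {F : Type*} [Field F] {n h : ℕ} (K : Set (ProjFlat F n h))
    (V : ProjFlat F n (h + 1)) (P : PG n F) : Prop :=
  P.submodule ≤ V.1 ∧ ∀ X : ProjFlat F n h, X.1 ≤ V.1 → (X ∈ K ↔ P.submodule ≤ X.1)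

/-- For a linear complex, each `(h + 1)`-subspace that is not total has a unique pole. -/
theorem existsUnique_pole {F : Type*} [Field F] {n h : ℕ} {K : Set (ProjFlat F n h)}
    (hK : IsLinearComplex K) (V : ProjFlat F n (h + 1)) (hV : ¬ IsTotalFlat K V) :
    ∃! P : PG n F, IsPole K V P := by
  obtain ⟨H, hH, rfl⟩ := hK
  -- a linear form with kernel `H`
  have hH' : IsCoatom (Projectivization.Subspace.submodule H) :=
    (OrderIso.isCoatom_iff _ H).2 hH
  obtain ⟨x, hx⟩ : ∃ x, x ∉ Projectivization.Subspace.submodule H := by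
    by_contra! hcon
    exact hH'.1 (Submodule.eq_top_iff'.2 hcon)
  obtain ⟨f, hfx, hf⟩ := Submodule.exists_le_ker_of_notMem hx
  have hker : LinearMap.ker f = Projectivization.Subspace.submodule H := by
    by_contra hne
    have := hH'.2 _ (lt_of_le_of_ne hf (Ne.symm hne))
    exact hfx (by rw [← LinearMap.mem_ker, this]; trivial)
  let b := Module.finBasisOfFinrankEq F V.1 V.2
  let ω : V.1 [⋀^Fin (h + 1)]→ₗ[F] F :=
    (f.compAlternatingMap (exteriorPower.ιMulti F (h + 1))).compLinearMap V.1.subtype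
  -- every alternating form of degree `h + 1` on `V` is a contraction of the determinant
  obtain ⟨p, hp⟩ : ∃ p : V.1, b.det.curryLeft p = ω := by
    let Φ : V.1 →ₗ[F] Module.Dual F (⋀[F]^(h + 1) V.1) :=
      (exteriorPower.alternatingMapLinearEquiv (R := F) (M := V.1) (N := F)
        (n := h + 1)).toLinearMap ∘ₗ b.det.curryLeft
    have hinj : Function.Injective Φ := by
      refine (exteriorPower.alternatingMapLinearEquiv (R := F) (M := V.1) (N := F)
        (n := h + 1)).injective.comp ?_
      refine (injective_iff_map_eq_zero b.det.curryLeft).2 fun p hp => ?_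
      apply b.ext_elem
      intro i
      have h1 : b.det (Matrix.vecCons p (fun j => b (i.succAbove j))) = 0 := by
        rw [← AlternatingMap.curryLeft_apply_apply, hp]; rfl
      rw [map_zero, Finsupp.zero_apply]
      by_contra hi
      have hli : LinearIndependent F (Matrix.vecCons p (fun j => b (i.succAbove j))) := by
        apply linearIndependent_finCons.2
        refine ⟨b.linearIndependent.comp _ Fin.succAbove_right_injective, fun hmem => hi ?_⟩
        have hle : Submodule.span F (Set.range fun j => b (i.succAbove j)) ≤
            LinearMap.ker (b.coord i) := by
          rw [Submodule.span_le]
          rintro _ ⟨j, rfl⟩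
          simp
        exact hle hmem
      have hne : b.det (Matrix.vecCons p (fun j => b (i.succAbove j))) ≠ 0 := by
        let e := basisOfLinearIndependentOfCardEqFinrank hli (by simp [V.2])
        have : (Matrix.vecCons p (fun j => b (i.succAbove j)) : Fin (h + 1 + 1) → V.1) = e := by
          simp [e]
        rw [this]
        exact (b.isUnit_det e).ne_zero
      exact hne h1
    have hdim : Module.finrank F V.1 = Module.finrank F (Module.Dual F (⋀[F]^(h + 1) V.1)) := by
      rw [Subspace.dual_finrank_eq, exteriorPower.finrank_eq, V.2, Nat.choose_succ_self_right]
    obtain ⟨p, hp⟩ := (LinearMap.injective_iff_surjective_of_finrank_eq_finrank hdim).1 hinj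
      (exteriorPower.alternatingMapLinearEquiv ω)
    exact ⟨p, (exteriorPower.alternatingMapLinearEquiv (R := F) (M := V.1) (N := F)
        (n := h + 1)).injective hp⟩
  have key : ∀ X : ProjFlat F n h, X.1 ≤ V.1 → (plucker X ∈ H ↔ (p : Vec F n) ∈ X.1) := by
    intro X hX
    let c := Module.finBasisOfFinrankEq F X.1 X.2
    let c' : Fin (h + 1) → V.1 := fun i => ⟨c i, hX (c i).2⟩
    have hc' : LinearIndependent F c' := by
      apply LinearIndependent.of_comp V.1.subtype
      exact c.linearIndependent.map' X.1.subtype (Submodule.ker_subtype _)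
    have h1 : plucker X ∈ H ↔ ω c' = 0 := by
      rw [plucker, ← Projectivization.Subspace.mem_submodule_iff, ← hker, LinearMap.mem_ker]
      rfl
    have h2 : Submodule.span F (Set.range c') = X.1.comap V.1.subtype := by
      apply Submodule.map_injective_of_injective V.1.injective_subtype
      rw [Submodule.map_comap_subtype, inf_eq_right.2 hX, Submodule.map_span, ← Set.range_comp]
      have h3 : (V.1.subtype ∘ c') = X.1.subtype ∘ c := rfl
      rw [h3, Set.range_comp, ← Submodule.map_span, c.span_eq, Submodule.map_top,
        Submodule.range_subtype]
    have h3 : (p : Vec F n) ∈ X.1 ↔ p ∈ Submodule.span F (Set.range c') := by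
      rw [h2]; rfl
    rw [h1, h3, ← hp, AlternatingMap.curryLeft_apply_apply]
    constructor
    · intro h0
      by_contra hmem
      have hli : LinearIndependent F (Matrix.vecCons p c') :=
        linearIndependent_finCons.2 ⟨hc', hmem⟩
      let e := basisOfLinearIndependentOfCardEqFinrank hli (by simp [V.2])
      have : (Matrix.vecCons p c' : Fin (h + 1 + 1) → V.1) = e := by
        simp [e]
      rw [this] at h0
      exact (b.isUnit_det e).ne_zero h0
    · intro hmem
      apply AlternatingMap.map_linearDependent
      intro hli
      exact (linearIndependent_finCons.1 hli).2 hmem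
  have hp0 : (p : Vec F n) ≠ 0 := by
    intro h0
    apply hV
    intro X hX
    exact (key X hX).2 (h0 ▸ X.1.zero_mem)
  have hiff : ∀ (Q : PG n F) (X : Submodule F (Vec F n)), Q.submodule ≤ X ↔ Q.rep ∈ X := by
    intro Q X
    rw [Projectivization.submodule_eq, Submodule.span_singleton_le_iff_mem]
  refine ⟨Projectivization.mk F p hp0, ⟨?_, ?_⟩, ?_⟩
  · rw [Projectivization.submodule_mk, Submodule.span_singleton_le_iff_mem]
    exact p.2
  · intro X hX
    rw [Projectivization.submodule_mk, Submodule.span_singleton_le_iff_mem]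
    exact key X hX
  · rintro Q ⟨hQV, hQ⟩
    -- a hyperplane of `V` through `p` that misses `Q`
    by_contra hne
    rw [hiff] at hQV
    let q : V.1 := ⟨Q.rep, hQV⟩
    have hq : q ∉ Submodule.span F {p} := by
      intro hmem
      obtain ⟨a, ha⟩ := Submodule.mem_span_singleton.1 hmem
      apply hne
      rw [← Q.mk_rep, Projectivization.mk_eq_mk_iff']
      exact ⟨a, congrArg Subtype.val ha⟩
    obtain ⟨g, hgq, hg⟩ := Submodule.exists_le_ker_of_notMem hq
    have hg0 : g ≠ 0 := by
      rintro rfl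
      exact hgq rfl
    have hr : Module.finrank F (LinearMap.range g) = 1 := by
      rw [LinearMap.range_eq_top.2 (LinearMap.surjective hg0), finrank_top, Module.finrank_self]
    have hk : Module.finrank F (LinearMap.ker g) = h + 1 := by
      have := g.finrank_range_add_finrank_ker
      rw [hr, V.2] at this
      omega
    let X : ProjFlat F n h := ⟨(LinearMap.ker g).map V.1.subtype, by
      rw [Submodule.finrank_map_subtype_eq, hk]⟩
    have hX : X.1 ≤ V.1 := Submodule.map_subtype_le _ _
    have hpX : (p : Vec F n) ∈ X.1 :=
      Submodule.mem_map_of_mem (hg (Submodule.mem_span_singleton_self p))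
    have hqX := (hiff Q X.1).1 ((hQ X hX).1 ((key X hX).2 hpX))
    obtain ⟨y, hy, hyq⟩ := hqX
    have : y = q := Subtype.ext hyq
    exact hgq (by rw [← this]; exact hy)

/-- The dual polarity of a linear complex `K` of `h`-subspaces: the partial map from the
`(h + 1)`-subspaces to the points of `PG(n, F)` whose exceptional elements are the total
`(h + 1)`-subspaces, and which assigns to every other `(h + 1)`-subspace its pole. -/
noncomputable def dualPolarity {F : Type*} [Field F] {n h : ℕ} (K : LinearComplex F n h) :
    ProjFlat F n (h + 1) →. PG n F :=
  fun V => ⟨¬ IsTotalFlat K.1 V, fun hV => (existsUnique_pole K.2 V hV).choose⟩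

/-! Let `K` consist of the `h`-subspaces X that contain V^χ for every V ⊇ X in the domain. If V₁^χ
is off X for one V₁ ⊇ X, then the pencil from X to V₁ + V₂ forces each V₂ ⊇ X to lie in the domain
with image off X (`IsLinearMapping.exists_image_not_le`). So a single V ⊇ X decides whether X ∈ K:
inside V, the members of K are those through V^χ, or all of them if V^χ is undefined. Hence χ is the
dual polarity of K as soon as K is a linear complex. Uniqueness holds because every X lies in some
V, whose pole decides whether X belongs to the complex.

What remains is one alternating form of degree h + 1 whose zeros are the tuples that are dependent
or span a member of K. The poles give this only slot by slot: with the other entries fixed, the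
remaining one runs through the kernel of a linear form (`HasPoleVectors.isSlotwiseHyperplane`).
Every predicate of this kind comes from an alternating form
(`IsSlotwiseHyperplane.exists_alternatingMap`), by induction on the degree and on a spanning set.
Passing from H to H ⊕ Fe, let ω₀ describe the predicate on H, ω₁ its contraction by e, and let ε be
dual to e. The candidate is ω₀ + c ε ∧ ω₁.

Each single tuple admits a nonzero c. That one c serves all tuples
(`IsSlotwiseHyperplane.exists_gluing_scalar`) is the crux: induction on the degree attaches a scalar
to each vector a, and the scalars of two generic vectors are compared through a third vector generic
to both. Such a vector exists if |F| ≥ 3; over the field of two elements the only nonzero scalar is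
1. -/

/-! ### Vectors outside several subspaces. -/

section Avoid

variable {F M : Type*} [Field F] [AddCommGroup M] [Module F M]

/-- A vector space is not the union of two proper subspaces. -/
theorem Submodule.exists_notMem_notMem {U₁ U₂ : Submodule F M} (h₁ : U₁ ≠ ⊤) (h₂ : U₂ ≠ ⊤) :
    ∃ x, x ∉ U₁ ∧ x ∉ U₂ := by
  by_contra! hc
  obtain ⟨x, hx⟩ : ∃ x, x ∉ U₁ := by
    by_contra! h; exact h₁ (Submodule.eq_top_iff'.2 h)
  obtain ⟨y, hy⟩ : ∃ y, y ∉ U₂ := by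
    by_contra! h; exact h₂ (Submodule.eq_top_iff'.2 h)
  have hx₂ := hc x hx
  have hy₁ : y ∈ U₁ := by
    by_contra h; exact hy (hc y h)
  have h1 : x + y ∉ U₁ := fun h => hx ((U₁.add_mem_iff_left hy₁).1 h)
  exact hy ((U₂.add_mem_iff_right hx₂).1 (hc _ h1))

/-- On a line `y + t x` not parallel to `U`, at most one point lies in `U`. -/
theorem Submodule.eq_of_add_smul_mem {U : Submodule F M} {x y : M} (hx : x ∉ U) {s t : F}
    (hs : y + s • x ∈ U) (ht : y + t • x ∈ U) : s = t := by
  have h := U.sub_mem hs ht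
  rw [add_sub_add_left_eq_sub, ← sub_smul] at h
  by_contra hne
  exact hx ((U.smul_mem_iff (sub_ne_zero.2 hne)).1 h)

/-- Over a field with at least three elements, a line whose direction lies in neither of two subspaces
has a point outside both. -/
theorem Submodule.exists_add_smul_notMem_notMem {r : F} (hr : r ≠ 0) (hr' : r ≠ 1)
    {U₁ U₂ : Submodule F M} {x : M} (h₁ : x ∉ U₁) (h₂ : x ∉ U₂) (y : M) :
    ∃ t : F, y + t • x ∉ U₁ ∧ y + t • x ∉ U₂ := by
  by_contra! hc
  -- Each subspace contains at most one point of the line, so two subspaces cannot cover the three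
  -- parameters 0, 1, r.
  have key : ∀ s t : F, s ≠ t → y + s • x ∈ U₁ → y + t • x ∈ U₂ := fun s t hst hs =>
    hc t fun ht => hst (Submodule.eq_of_add_smul_mem h₁ hs ht)
  have key2 : ∀ s t : F, s ≠ t → y + s • x ∈ U₂ → y + t • x ∈ U₁ := fun s t hst hs => by
    by_contra h
    exact hst (Submodule.eq_of_add_smul_mem h₂ hs (hc t h))
  by_cases h0 : y + (0 : F) • x ∈ U₁
  · exact hr' (Submodule.eq_of_add_smul_mem h₂ (key _ _ hr.symm h0) (key _ _ zero_ne_one h0))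
  · exact hr' (Submodule.eq_of_add_smul_mem h₁ (key2 _ _ hr.symm (hc 0 h0))
      (key2 _ _ zero_ne_one (hc 0 h0)))

/-- Over a field with at least three elements, a vector space is not the union of three proper
subspaces. -/
theorem Submodule.exists_notMem_three {r : F} (hr : r ≠ 0) (hr' : r ≠ 1)
    {U₁ U₂ U₃ : Submodule F M} (h₁ : U₁ ≠ ⊤) (h₂ : U₂ ≠ ⊤) (h₃ : U₃ ≠ ⊤) :
    ∃ x, x ∉ U₁ ∧ x ∉ U₂ ∧ x ∉ U₃ := by
  obtain ⟨x, hx₁, hx₂⟩ := Submodule.exists_notMem_notMem h₁ h₂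
  by_cases hx : x ∈ U₃
  -- Starting at y outside U₃ and moving in the direction x ∈ U₃ never enters U₃.
  · obtain ⟨y, hy, -⟩ := Submodule.exists_notMem_notMem h₃ h₃
    obtain ⟨t, ht₁, ht₂⟩ := Submodule.exists_add_smul_notMem_notMem hr hr' hx₁ hx₂ y
    exact ⟨_, ht₁, ht₂, fun h => hy ((U₃.add_mem_iff_left (U₃.smul_mem t hx)).1 h)⟩
  · exact ⟨x, hx₁, hx₂, hx⟩

/-- Over a field with at least three elements, a vector space is not the union of two proper
subspaces and two subspaces of codimension at least two. -/
theorem Submodule.exists_notMem_four {r : F} (hr : r ≠ 0) (hr' : r ≠ 1)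
    {U₁ U₂ W₁ W₂ : Submodule F M} (h₁ : U₁ ≠ ⊤) (h₂ : U₂ ≠ ⊤)
    (h₃ : ∀ x, W₁ ⊔ Submodule.span F {x} ≠ ⊤) (h₄ : ∀ x, W₂ ⊔ Submodule.span F {x} ≠ ⊤) :
    ∃ x, x ∉ U₁ ∧ x ∉ U₂ ∧ x ∉ W₁ ∧ x ∉ W₂ := by
  obtain ⟨x, hx₁, hx₂⟩ := Submodule.exists_notMem_notMem h₁ h₂
  -- With y outside each Wᵢ + Fx, the whole line y + Fx misses both Wᵢ.
  obtain ⟨y, hy₁, hy₂⟩ := Submodule.exists_notMem_notMem (h₃ x) (h₄ x)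
  obtain ⟨t, ht₁, ht₂⟩ := Submodule.exists_add_smul_notMem_notMem hr hr' hx₁ hx₂ y
  have key : ∀ W : Submodule F M, y ∉ W ⊔ Submodule.span F {x} → y + t • x ∉ W := by
    intro W hW h
    apply hW
    have hx : t • x ∈ W ⊔ Submodule.span F {x} :=
      Submodule.mem_sup_right (Submodule.smul_mem _ _ (Submodule.mem_span_singleton_self x))
    exact ((W ⊔ Submodule.span F {x}).add_mem_iff_left hx).1 (Submodule.mem_sup_left h)
  exact ⟨_, ht₁, ht₂, key _ hy₁, key _ hy₂⟩

/-- A subspace of codimension at most one is the kernel of a linear form. -/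
theorem Submodule.exists_dual_mem_iff (S : Submodule F M)
    (hS : ∀ x y, y ∉ S → ∃ r : F, x - r • y ∈ S) :
    ∃ f : M →ₗ[F] F, ∀ x, x ∈ S ↔ f x = 0 := by
  by_cases htop : S = ⊤
  · exact ⟨0, fun x => by simp [htop]⟩
  obtain ⟨y, hy, -⟩ := Submodule.exists_notMem_notMem htop htop
  obtain ⟨f, hfy, hf⟩ := Submodule.exists_le_ker_of_notMem hy
  refine ⟨f, fun x => ⟨fun hx => hf hx, fun hx => ?_⟩⟩
  obtain ⟨r, hr⟩ := hS x y hy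
  have h1 : f (x - r • y) = 0 := hf hr
  rw [map_sub, map_smul, hx, zero_sub, neg_eq_zero, smul_eq_mul] at h1
  rcases mul_eq_zero.1 h1 with h | h
  · simpa [h] using hr
  · exact absurd h hfy

end Avoid

/-! ### Alternating forms and slotwise hyperplanes. -/

section Tuples

variable {F M V : Type*} [Field F] [AddCommGroup M] [Module F M] [AddCommGroup V] [Module F V]

theorem Matrix.vecCons_vecCons_comp_swap {α : Type*} {k : ℕ} (x y : α) (g : Fin k → α) :
    Matrix.vecCons x (Matrix.vecCons y g) ∘ Equiv.swap 0 1 =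
      Matrix.vecCons y (Matrix.vecCons x g) := by
  funext i
  refine Fin.cases ?_ (fun j => ?_) i
  · simp
  · refine Fin.cases ?_ (fun l => ?_) j
    · simp
    · have h1 : (l.succ.succ : Fin (k + 2)) ≠ 1 := by
        rw [← Fin.succ_zero_eq_one, Ne, Fin.succ_inj]
        exact Fin.succ_ne_zero l
      simp [Equiv.swap_apply_of_ne_of_ne (Fin.succ_ne_zero _) h1]

theorem Function.comp_vecCons {α β : Type*} {k : ℕ} (f : α → β) (x : α) (g : Fin k → α) :
    f ∘ Matrix.vecCons x g = Matrix.vecCons (f x) (f ∘ g) := by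
  funext i
  exact Fin.cases rfl (fun _ => rfl) i

theorem AlternatingMap.map_vecCons_vecCons_comm {k : ℕ} (ω : M [⋀^Fin (k + 2)]→ₗ[F] F) (x y : M)
    (g : Fin k → M) :
    ω (Matrix.vecCons x (Matrix.vecCons y g)) = -ω (Matrix.vecCons y (Matrix.vecCons x g)) := by
  rw [← Matrix.vecCons_vecCons_comp_swap y x, ω.map_swap _ (by simp)]

theorem AlternatingMap.ker_curryLeft_ne_top {k : ℕ} {α : M [⋀^Fin (k + 1)]→ₗ[F] F}
    (hα : α ≠ 0) : LinearMap.ker α.curryLeft ≠ ⊤ := by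
  intro h
  apply hα
  ext g
  have h1 : α.curryLeft (g 0) = 0 := by
    rw [← LinearMap.mem_ker, h]; trivial
  have h2 := AlternatingMap.congr_fun h1 (Matrix.vecTail g)
  rw [AlternatingMap.curryLeft_apply_apply] at h2
  have h3 : Matrix.vecCons (g 0) (Matrix.vecTail g) = g := Matrix.cons_head_tail g
  rwa [h3] at h2

/-- Two nonzero alternating forms of the same degree have a common tuple of non-zeros. -/
theorem AlternatingMap.exists_apply_ne_zero : ∀ {k : ℕ} {α β : M [⋀^Fin k]→ₗ[F] F},
    α ≠ 0 → β ≠ 0 → ∃ g, α g ≠ 0 ∧ β g ≠ 0 := by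
  intro k
  induction k with
  | zero =>
    intro α β hα hβ
    refine ⟨Fin.elim0, fun h => hα ?_, fun h => hβ ?_⟩ <;>
    · ext g
      rw [Subsingleton.elim g Fin.elim0, h]; rfl
  | succ k ih =>
    intro α β hα hβ
    obtain ⟨x, hx₁, hx₂⟩ := Submodule.exists_notMem_notMem
      (AlternatingMap.ker_curryLeft_ne_top hα) (AlternatingMap.ker_curryLeft_ne_top hβ)
    obtain ⟨g, hg₁, hg₂⟩ := ih (α := α.curryLeft x) (β := β.curryLeft x) hx₁ hx₂
    exact ⟨Matrix.vecCons x g, hg₁, hg₂⟩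

/-- The radical of a nonzero alternating form of degree at least two has codimension at least
two. -/
theorem AlternatingMap.ker_curryLeft_sup_span_ne_top {k : ℕ} {α : M [⋀^Fin (k + 2)]→ₗ[F] F}
    (hα : α ≠ 0) (x : M) : LinearMap.ker α.curryLeft ⊔ Submodule.span F {x} ≠ ⊤ := by
  intro htop
  apply AlternatingMap.ker_curryLeft_ne_top hα
  have key : ∀ w ∈ LinearMap.ker α.curryLeft, ∀ g, α (Matrix.vecCons w g) = 0 := by
    intro w hw g
    exact AlternatingMap.congr_fun (LinearMap.mem_ker.1 hw) g
  -- x is itself in the radical: in α(x, w + t x, …) the w-term vanishes and the x-term repeats an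
  -- entry.
  have hx : x ∈ LinearMap.ker α.curryLeft := by
    rw [LinearMap.mem_ker]
    ext g
    have hy : Matrix.vecHead g ∈ LinearMap.ker α.curryLeft ⊔ Submodule.span F {x} := by
      rw [htop]; trivial
    obtain ⟨w, hw, z, hz, hwz⟩ := Submodule.mem_sup.1 hy
    obtain ⟨t, rfl⟩ := Submodule.mem_span_singleton.1 hz
    rw [AlternatingMap.curryLeft_apply_apply, ← Matrix.cons_head_tail g, ← hwz,
      AlternatingMap.map_vecCons_vecCons_comm, AlternatingMap.map_vecCons_add, key w hw,
      AlternatingMap.map_vecCons_smul,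
      α.map_eq_zero_of_eq (i := 0) (j := 1) _ (by simp) (by simp)]
    simp
  rwa [sup_eq_left.2 ((Submodule.span_singleton_le_iff_mem _ _).2 hx)] at htop

/-- A predicate on tuples of vectors behaving like the vanishing of an alternating form: in each
slot it is the vanishing of a linear form, and it holds whenever two entries agree. -/
structure IsSlotwiseHyperplane (F : Type*) {V : Type*} [Field F] [AddCommGroup V] [Module F V]
    {k : ℕ} (Z : (Fin k → V) → Prop) : Prop where
  slot : ∀ v i, ∃ f : V →ₗ[F] F, ∀ x, Z (Function.update v i x) ↔ f x = 0
  alt : ∀ v i j, i ≠ j → v i = v j → Z v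

/-- Allows the same normalisation of tuples to be applied to a predicate and to the form meant to
describe it. -/
theorem AlternatingMap.isSlotwiseHyperplane {k : ℕ} (ω : V [⋀^Fin k]→ₗ[F] F) :
    IsSlotwiseHyperplane F (fun v => ω v = 0) where
  slot v i := ⟨ω.toMultilinearMap.toLinearMap v i, fun _ => Iff.rfl⟩
  alt v _ _ hij h := ω.map_eq_zero_of_eq v h hij

namespace IsSlotwiseHyperplane

variable {k : ℕ} {Z : (Fin k → V) → Prop}

theorem update_smul (hZ : IsSlotwiseHyperplane F Z) (v : Fin k → V) (i : Fin k) (x : V) {c : F}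
    (hc : c ≠ 0) : Z (Function.update v i (c • x)) ↔ Z (Function.update v i x) := by
  obtain ⟨f, hf⟩ := hZ.slot v i
  rw [hf, hf, map_smul, smul_eq_zero_iff_right hc]

theorem update_add_smul (hZ : IsSlotwiseHyperplane F Z) (v : Fin k → V) {i j : Fin k}
    (hij : i ≠ j) (x : V) (c : F) :
    Z (Function.update v i (x + c • v j)) ↔ Z (Function.update v i x) := by
  obtain ⟨f, hf⟩ := hZ.slot v i
  have h0 : f (v j) = 0 := (hf _).1 (hZ.alt _ i j hij (by simp [hij.symm]))
  rw [hf, hf, map_add, map_smul, h0, smul_zero, add_zero]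

/-- A transposition is three shears and a sign change: (a, b) → (a + b, b) → (a + b, −a) → (b, −a) →
(b, a). -/
theorem comp_swap (hZ : IsSlotwiseHyperplane F Z) (v : Fin k → V) (i j : Fin k) :
    Z (v ∘ Equiv.swap i j) ↔ Z v := by
  by_cases hij : i = j
  · subst hij; simp
  have e1 := hZ.update_add_smul v hij (v i) 1
  rw [Function.update_eq_self] at e1
  rw [← e1]
  set v1 := Function.update v i (v i + (1 : F) • v j) with hv1
  have e2 := hZ.update_add_smul v1 (Ne.symm hij) (v1 j) (-1)
  rw [Function.update_eq_self] at e2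
  rw [← e2]
  set v2 := Function.update v1 j (v1 j + (-1 : F) • v1 i) with hv2
  have e3 := hZ.update_add_smul v2 hij (v2 i) 1
  rw [Function.update_eq_self] at e3
  rw [← e3]
  set v3 := Function.update v2 i (v2 i + (1 : F) • v2 j) with hv3
  have e4 := hZ.update_smul v3 j (v3 j) (neg_ne_zero.2 (one_ne_zero (α := F)))
  rw [Function.update_eq_self] at e4
  rw [← e4]
  apply iff_of_eq
  congr 1
  have hji : j ≠ i := Ne.symm hij
  funext l
  by_cases hl : l = i
  · subst hl
    simp [hv3, hv2, hv1, hij, hji]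
  · by_cases hl' : l = j
    · subst hl'
      simp [hv3, hv2, hv1, hl]
    · simp [hv3, hv2, hv1, hl, hl', Equiv.swap_apply_of_ne_of_ne hl hl']

theorem vecCons_comm {k : ℕ} {Z : (Fin (k + 2) → V) → Prop} (hZ : IsSlotwiseHyperplane F Z)
    (x y : V) (g : Fin k → V) :
    Z (Matrix.vecCons x (Matrix.vecCons y g)) ↔ Z (Matrix.vecCons y (Matrix.vecCons x g)) := by
  rw [← Matrix.vecCons_vecCons_comp_swap y x, hZ.comp_swap]

theorem slot_zero {k : ℕ} {Z : (Fin (k + 1) → V) → Prop} (hZ : IsSlotwiseHyperplane F Z)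
    (g : Fin k → V) : ∃ f : V →ₗ[F] F, ∀ x, Z (Matrix.vecCons x g) ↔ f x = 0 := by
  obtain ⟨f, hf⟩ := hZ.slot (Matrix.vecCons 0 g) 0
  refine ⟨f, fun x => ?_⟩
  have h : Function.update (Matrix.vecCons 0 g) 0 x = Matrix.vecCons x g :=
    Fin.update_cons_zero (α := fun _ => V) 0 g x
  rw [← hf, h]

/-- Fixing the first entry lowers the degree by one; both inductions on the degree rest on this. -/
theorem contract {k : ℕ} {Z : (Fin (k + 1) → V) → Prop} (hZ : IsSlotwiseHyperplane F Z) (a : V) :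
    IsSlotwiseHyperplane F (fun v => Z (Matrix.vecCons a v)) where
  slot v i := by
    obtain ⟨f, hf⟩ := hZ.slot (Matrix.vecCons a v) i.succ
    refine ⟨f, fun x => ?_⟩
    rw [← hf, Matrix.vecCons, Fin.cons_update]; rfl
  alt v i j hij h := hZ.alt _ i.succ j.succ (by simpa using hij) (by simpa using h)

/-- Adding multiples of the entry `j` to the other entries does not matter. -/
theorem add_smul_iff (hZ : IsSlotwiseHyperplane F Z) (v : Fin k → V) (j : Fin k) (c : Fin k → F)
    (hc : c j = 0) : Z (fun i => v i + c i • v j) ↔ Z v := by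
  classical
  have key : ∀ s : Finset (Fin k), Z (fun i => if i ∈ s then v i + c i • v j else v i) ↔ Z v := by
    intro s
    induction s using Finset.induction_on with
    | empty => simp
    | insert a s ha ih =>
      rw [← ih]
      by_cases haj : a = j
      · subst haj
        apply iff_of_eq
        congr 1
        funext i
        by_cases hi : i = a
        · subst hi; simp [hc]
        · simp [hi]
      · set w : Fin k → V := fun i => if i ∈ s then v i + c i • v j else v i with hw
        have hwj : w j = v j := by simp [hw, hc]
        have := hZ.update_add_smul w haj (w a) (c a)
        rw [Function.update_eq_self] at this
        rw [← this]
        apply iff_of_eq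
        congr 1
        funext i
        by_cases hi : i = a
        · subst hi; simp [hwj]; simp [hw, ha]
        · simp [hi, hw]
  simpa using key Finset.univ

end IsSlotwiseHyperplane

end Tuples

/-! ### The gluing scalar and its independence of the tuple. -/

section Gluing

variable {F M V : Type*} [Field F] [AddCommGroup M] [Module F M] [AddCommGroup V] [Module F V]

/-- Two linear forms with the same kernel are proportional. -/
theorem LinearMap.exists_smul_eq_of_ker_eq {f f' : M →ₗ[F] F} (h : ∀ x, f x = 0 ↔ f' x = 0)
    {x₀ : M} (hx₀ : f' x₀ ≠ 0) : ∃ c : F, c ≠ 0 ∧ ∀ x, f x = c * f' x := by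
  refine ⟨f x₀ / f' x₀, div_ne_zero ((h x₀).not.2 hx₀) hx₀, fun x => ?_⟩
  have h1 : f (x - (f' x / f' x₀) • x₀) = 0 := by
    rw [h, map_sub, map_smul, smul_eq_mul, div_mul_cancel₀ _ hx₀, sub_self]
  rw [map_sub, map_smul, smul_eq_mul, sub_eq_zero] at h1
  rw [h1]
  field_simp

/-- For a single tuple `g`, the two local equations of a slotwise hyperplane combine. -/
theorem IsSlotwiseHyperplane.exists_scalar_of_tuple {m : ℕ} {Z : (Fin (m + 1) → V) → Prop}
    (hZ : IsSlotwiseHyperplane F Z) (i : M →ₗ[F] V) (e : V) (ω₀ : M [⋀^Fin (m + 1)]→ₗ[F] F)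
    (ω₁ : M [⋀^Fin m]→ₗ[F] F) (h₀ : ∀ v, Z (i ∘ v) ↔ ω₀ v = 0)
    (h₁ : ∀ g, Z (Matrix.vecCons e (i ∘ g)) ↔ ω₁ g = 0) (g : Fin m → M) :
    ∃ c : F, c ≠ 0 ∧ ∀ x, Z (Matrix.vecCons (e + i x) (i ∘ g)) ↔
      ω₀ (Matrix.vecCons x g) + c * ω₁ g = 0 := by
  obtain ⟨f, hf⟩ := hZ.slot_zero (i ∘ g)
  have he : f e = 0 ↔ ω₁ g = 0 := by rw [← hf, h₁]
  have hx : ∀ x, f (i x) = 0 ↔ ω₀ (Matrix.vecCons x g) = 0 := by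
    intro x
    rw [← hf, ← Function.comp_vecCons, h₀]
  -- If ω₁ g = 0 or ω₀(·, g) = 0, every nonzero scalar works. Otherwise f ∘ i and ω₀(·, g) have the
  -- same kernel, hence are proportional, and f e fixes the scalar.
  by_cases hg : ω₁ g = 0
  · refine ⟨1, one_ne_zero, fun x => ?_⟩
    rw [hf, map_add, he.2 hg, hg, zero_add, hx, mul_zero, add_zero]
  by_cases hall : ∀ x, ω₀ (Matrix.vecCons x g) = 0
  · refine ⟨1, one_ne_zero, fun x => ?_⟩
    rw [hf, map_add, (hx x).2 (hall x), hall, zero_add, add_zero, he, one_mul]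
  push Not at hall
  obtain ⟨x₀, hx₀⟩ := hall
  let φ : M →ₗ[F] F :=
    { toFun := fun x => ω₀ (Matrix.vecCons x g)
      map_add' := fun x y => ω₀.map_vecCons_add g x y
      map_smul' := fun c x => ω₀.map_vecCons_smul g c x }
  obtain ⟨c, hc, hcφ⟩ := LinearMap.exists_smul_eq_of_ker_eq (f := f ∘ₗ i) (f' := φ) hx hx₀
  refine ⟨f e / (c * ω₁ g), div_ne_zero (he.not.2 hg) (mul_ne_zero hc hg), fun x => ?_⟩
  have h2 : f (i x) = c * ω₀ (Matrix.vecCons x g) := hcφ x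
  rw [hf, map_add, h2]
  have h3 : f e + c * ω₀ (Matrix.vecCons x g) =
      c * (ω₀ (Matrix.vecCons x g) + f e / (c * ω₁ g) * ω₁ g) := by
    field_simp
    ring
  rw [h3, mul_eq_zero_iff_left hc]

/-- Comparison of the gluing scalars of two vectors `a`, `b` that are generic to each other, for
forms of degree one and two. -/
theorem IsSlotwiseHyperplane.scalar_eq_of_bilinear {Z : (Fin 2 → V) → Prop}
    (hZ : IsSlotwiseHyperplane F Z) (i : M →ₗ[F] V) (e : V) (ω₀ : M [⋀^Fin 2]→ₗ[F] F)
    (ω₁ : M [⋀^Fin 1]→ₗ[F] F) (h₀ : ∀ v, Z (i ∘ v) ↔ ω₀ v = 0)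
    (h₁ : ∀ g, Z (Matrix.vecCons e (i ∘ g)) ↔ ω₁ g = 0) {a b : M} {c d : F}
    (hc : ∀ x g, Z (Matrix.vecCons (e + i x) (i ∘ Matrix.vecCons a g)) ↔
      ω₀ (Matrix.vecCons x (Matrix.vecCons a g)) + c * ω₁ (Matrix.vecCons a g) = 0)
    (hd : ∀ x g, Z (Matrix.vecCons (e + i x) (i ∘ Matrix.vecCons b g)) ↔
      ω₀ (Matrix.vecCons x (Matrix.vecCons b g)) + d * ω₁ (Matrix.vecCons b g) = 0)
    {g : Fin 0 → M} (ha : ω₁ (Matrix.vecCons a g) ≠ 0) (hb : ω₁ (Matrix.vecCons b g) ≠ 0)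
    (hab : ω₀ (Matrix.vecCons a (Matrix.vecCons b g)) ≠ 0) : c = d := by
  set φ : M → F := fun x => ω₁ (Matrix.vecCons x g) with hφ
  set β : M → M → F := fun x y => ω₀ (Matrix.vecCons x (Matrix.vecCons y g)) with hβ
  change φ a ≠ 0 at ha
  change φ b ≠ 0 at hb
  change β a b ≠ 0 at hab
  have hβab : β b a = - β a b := ω₀.map_vecCons_vecCons_comm b a g
  have hβaa : β a a = 0 :=
    ω₀.map_eq_zero_of_eq (i := 0) (j := 1) _ (by simp) (by simp)
  have hβbb : β b b = 0 :=
    ω₀.map_eq_zero_of_eq (i := 0) (j := 1) _ (by simp) (by simp)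
  have hβ_add : ∀ x x' y, β (x + x') y = β x y + β x' y := fun x x' y =>
    ω₀.map_vecCons_add _ x x'
  have hβ_smul : ∀ t x y, β (t • x) y = t * β x y := fun t x y => ω₀.map_vecCons_smul _ t x
  have hφ_add : ∀ x x', φ (x + x') = φ x + φ x' := fun x x' => ω₁.map_vecCons_add _ x x'
  have hφ_smul : ∀ t x, φ (t • x) = t * φ x := fun t x => ω₁.map_vecCons_smul _ t x
  -- the linear form with kernel the vectors orthogonal to `e + i x`
  set s : F := - c * φ a / (φ a * β b a) with hs
  -- x is a multiple of the vector φ(a) b − φ(b) a in the kernel of φ, scaled so that β(x, a) = −c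
  -- φ(a). It then also satisfies β(x, b) = −c φ(b).
  set x : M := s • (φ a • b + (- φ b) • a) with hx
  have hxa : β x a = - c * φ a := by
    rw [hx, hβ_smul, hβ_add, hβ_smul, hβ_smul, hβaa, mul_zero, add_zero, hs]
    have : β b a ≠ 0 := by rw [hβab]; exact neg_ne_zero.2 hab
    field_simp
  have hxb : β x b = - c * φ b := by
    rw [hx, hβ_smul, hβ_add, hβ_smul, hβ_smul, hβbb, mul_zero, zero_add, hs, hβab]
    field_simp
  have hZc : ∀ (v : V) y, Z (Matrix.vecCons v (i ∘ Matrix.vecCons y g)) ↔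
      Z (Matrix.vecCons (i y) (Matrix.vecCons v (i ∘ g))) := by
    intro v y
    rw [Function.comp_vecCons, hZ.vecCons_comm]
  obtain ⟨f, hf⟩ := hZ.slot_zero (Matrix.vecCons (e + i x) (i ∘ g))
  have hfa : f (i a) = 0 := by
    rw [← hf, ← hZc, hc x g]
    change β x a + c * φ a = 0
    rw [hxa]; ring
  -- For y = φ(a) b − φ(b) a, both e (as φ(y) = 0) and i x (as x is a multiple of y) are orthogonal
  -- to i y. Linearity in the slots transfers orthogonality to e + i x from a and y to b, where the
  -- scalar d applies.
  have hfd : f (i (φ a • b + (- φ b) • a)) = 0 := by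
    rw [← hf, ← hZc]
    set y := φ a • b + (- φ b) • a with hy
    obtain ⟨f', hf'⟩ := hZ.slot_zero (i ∘ Matrix.vecCons y g)
    rw [hf', map_add]
    have h3 : f' e = 0 := by
      rw [← hf', h₁]
      change φ y = 0
      rw [hy, hφ_add, hφ_smul, hφ_smul]; ring
    have h4 : f' (i x) = 0 := by
      rw [← hf', ← Function.comp_vecCons, h₀]
      change β x y = 0
      rw [hx, hβ_smul]
      have : β y y = 0 := ω₀.map_eq_zero_of_eq (i := 0) (j := 1) _ (by simp) (by simp)
      rw [this, mul_zero]
    rw [h3, h4, add_zero]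
  have hfb : f (i b) = 0 := by
    rw [map_add, map_smul, map_smul, map_add, map_smul, map_smul, hfa, smul_zero, add_zero,
      smul_eq_mul] at hfd
    exact (mul_eq_zero.1 hfd).resolve_left ha
  have h5 : β x b + d * φ b = 0 := by
    rw [← hf, ← hZc] at hfb
    exact (hd x g).1 hfb
  rw [hxb] at h5
  have h6 : (d - c) * φ b = 0 := by linear_combination h5
  exact (sub_eq_zero.1 ((mul_eq_zero.1 h6).resolve_right hb)).symm

/-- Comparison of the gluing scalars of two vectors `a`, `b` whose contractions are nonzero, for
forms of higher degree. -/
theorem IsSlotwiseHyperplane.scalar_eq_of_contract_ne_zero {m : ℕ}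
    {Z : (Fin (m + 3) → V) → Prop} (hZ : IsSlotwiseHyperplane F Z) (i : M →ₗ[F] V) (e : V)
    (ω₀ : M [⋀^Fin (m + 3)]→ₗ[F] F) (ω₁ : M [⋀^Fin (m + 2)]→ₗ[F] F) {a b : M} {c d : F}
    (hc : ∀ x g, Z (Matrix.vecCons (e + i x) (i ∘ Matrix.vecCons a g)) ↔
      ω₀ (Matrix.vecCons x (Matrix.vecCons a g)) + c * ω₁ (Matrix.vecCons a g) = 0)
    (hd : ∀ x g, Z (Matrix.vecCons (e + i x) (i ∘ Matrix.vecCons b g)) ↔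
      ω₀ (Matrix.vecCons x (Matrix.vecCons b g)) + d * ω₁ (Matrix.vecCons b g) = 0)
    (hab₁ : (ω₁.curryLeft a).curryLeft b ≠ 0) (hab₀ : (ω₀.curryLeft a).curryLeft b ≠ 0) :
    c = d := by
  obtain ⟨x₀, hx₀, -⟩ := Submodule.exists_notMem_notMem
    (AlternatingMap.ker_curryLeft_ne_top hab₀) (AlternatingMap.ker_curryLeft_ne_top hab₀)
  obtain ⟨g, hg₁, hg₀⟩ := AlternatingMap.exists_apply_ne_zero hab₁
    (β := ((ω₀.curryLeft a).curryLeft b).curryLeft x₀) hx₀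
  change ω₁ (Matrix.vecCons a (Matrix.vecCons b g)) ≠ 0 at hg₁
  change ω₀ (Matrix.vecCons a (Matrix.vecCons b (Matrix.vecCons x₀ g))) ≠ 0 at hg₀
  have hperm : ∀ x, ω₀ (Matrix.vecCons x (Matrix.vecCons a (Matrix.vecCons b g))) =
      - ω₀ (Matrix.vecCons x (Matrix.vecCons b (Matrix.vecCons a g))) := fun x =>
    (ω₀.curryLeft x).map_vecCons_vecCons_comm a b g
  have hg₀' : ω₀ (Matrix.vecCons x₀ (Matrix.vecCons a (Matrix.vecCons b g))) ≠ 0 := by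
    have h1 : ω₀ (Matrix.vecCons a (Matrix.vecCons b (Matrix.vecCons x₀ g))) =
        - ω₀ (Matrix.vecCons a (Matrix.vecCons x₀ (Matrix.vecCons b g))) :=
      (ω₀.curryLeft a).map_vecCons_vecCons_comm b x₀ g
    rw [h1, ω₀.map_vecCons_vecCons_comm, neg_neg] at hg₀
    exact hg₀
  -- s solves ω₀(s x₀, a, b, g) + c ω₁(a, b, g) = 0. Exchanging a and b keeps the predicate true and
  -- negates both forms, so d satisfies the same equation.
  set s := - c * ω₁ (Matrix.vecCons a (Matrix.vecCons b g)) /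
    ω₀ (Matrix.vecCons x₀ (Matrix.vecCons a (Matrix.vecCons b g))) with hs
  have h1 : ω₀ (Matrix.vecCons (s • x₀) (Matrix.vecCons a (Matrix.vecCons b g))) =
      - c * ω₁ (Matrix.vecCons a (Matrix.vecCons b g)) := by
    rw [ω₀.map_vecCons_smul, smul_eq_mul, hs, div_mul_cancel₀ _ hg₀']
  have h2 : Z (Matrix.vecCons (e + i (s • x₀))
      (i ∘ Matrix.vecCons a (Matrix.vecCons b g))) := by
    rw [hc, h1]; ring
  have h3 : Z (Matrix.vecCons (e + i (s • x₀))
      (i ∘ Matrix.vecCons b (Matrix.vecCons a g))) := by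
    rw [Function.comp_vecCons, Function.comp_vecCons] at h2 ⊢
    exact ((hZ.contract _).vecCons_comm _ _ _).1 h2
  rw [hd, ω₁.map_vecCons_vecCons_comm b a] at h3
  rw [hperm] at h1
  have h6 : (c - d) * ω₁ (Matrix.vecCons a (Matrix.vecCons b g)) = 0 := by
    linear_combination h3 + h1
  exact sub_eq_zero.1 ((mul_eq_zero.1 h6).resolve_right hg₁)

/-- If a slotwise hyperplane is given by an alternating form on a subspace, and its contraction by
a further vector `e` is given by an alternating form as well, then the two equations glue. -/
theorem IsSlotwiseHyperplane.exists_gluing_scalar (i : M →ₗ[F] V) (e : V) :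
    ∀ {m : ℕ} {Z : (Fin (m + 1) → V) → Prop}, IsSlotwiseHyperplane F Z →
    ∀ (ω₀ : M [⋀^Fin (m + 1)]→ₗ[F] F) (ω₁ : M [⋀^Fin m]→ₗ[F] F),
    (∀ v, Z (i ∘ v) ↔ ω₀ v = 0) → (∀ g, Z (Matrix.vecCons e (i ∘ g)) ↔ ω₁ g = 0) →
    ∃ c : F, c ≠ 0 ∧ ∀ x g, Z (Matrix.vecCons (e + i x) (i ∘ g)) ↔
      ω₀ (Matrix.vecCons x g) + c * ω₁ g = 0 := by
  intro m
  induction m with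
  | zero =>
    intro Z hZ ω₀ ω₁ h₀ h₁
    obtain ⟨c, hc, h⟩ := hZ.exists_scalar_of_tuple i e ω₀ ω₁ h₀ h₁ Fin.elim0
    refine ⟨c, hc, fun x g => ?_⟩
    rw [Subsingleton.elim g Fin.elim0]
    exact h x
  | succ m ih =>
    intro Z hZ ω₀ ω₁ h₀ h₁
    have hloc : ∀ a : M, ∃ c : F, c ≠ 0 ∧
        ∀ x g, Z (Matrix.vecCons (e + i x) (i ∘ Matrix.vecCons a g)) ↔
          ω₀ (Matrix.vecCons x (Matrix.vecCons a g)) + c * ω₁ (Matrix.vecCons a g) = 0 := by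
      intro a
      obtain ⟨c, hc, h⟩ := ih (hZ.contract (i a)) (ω₀.curryLeft a) (ω₁.curryLeft a)
        (fun v => by rw [← Function.comp_vecCons, h₀]; rfl)
        (fun g => by rw [hZ.vecCons_comm, ← Function.comp_vecCons, h₁]; rfl)
      -- Moving a behind x changes the sign of the ω₀-term only.
      refine ⟨-c, neg_ne_zero.2 hc, fun x g => ?_⟩
      rw [Function.comp_vecCons, hZ.vecCons_comm, h, AlternatingMap.curryLeft_apply_apply,
        AlternatingMap.curryLeft_apply_apply, ω₀.map_vecCons_vecCons_comm x a,
        ← neg_eq_zero, neg_add, neg_mul]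
    choose c hc hloc using hloc
    -- the scalars of generic vectors agree
    have hconst : ∀ a a', ω₀.curryLeft a ≠ 0 → ω₁.curryLeft a ≠ 0 →
        ω₀.curryLeft a' ≠ 0 → ω₁.curryLeft a' ≠ 0 → c a = c a' := by
      intro a a' ha₀ ha₁ ha'₀ ha'₁
      by_cases hF : ∃ r : F, r ≠ 0 ∧ r ≠ 1
      swap
      · push Not at hF
        rw [hF _ (hc a), hF _ (hc a')]
      obtain ⟨r, hr, hr'⟩ := hF
      -- Here ω₀ and ω₁ have degrees 2 and 1 in the first case, where ω₁ cannot be contracted by two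
      -- vectors and the bilinear comparison takes over. In higher degree four subspaces must be
      -- avoided; four hyperplanes can cover the space over the field of three elements, so it
      -- matters that two of them are radicals of codimension at least two.
      cases m with
      | zero =>
        obtain ⟨b, hb, hb', hb₁⟩ := Submodule.exists_notMem_three hr hr'
          (AlternatingMap.ker_curryLeft_ne_top ha₀) (AlternatingMap.ker_curryLeft_ne_top ha'₀)
          (AlternatingMap.ker_curryLeft_ne_top (α := ω₁) (by rintro rfl; exact ha₁ rfl))
        have key : ∀ {k : ℕ} {θ : M [⋀^Fin k]→ₗ[F] F} (g : Fin k → M), k = 0 → θ ≠ 0 →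
            θ g ≠ 0 := by
          rintro k θ g rfl hθ h
          apply hθ
          ext g'
          rw [Subsingleton.elim g' g, h]; rfl
        have key2 : ∀ a, ω₁.curryLeft a ≠ 0 → b ∉ LinearMap.ker (ω₀.curryLeft a).curryLeft →
            c a = c b := fun a ha₁ hb =>
          hZ.scalar_eq_of_bilinear i e ω₀ ω₁ h₀ h₁ (hloc a) (hloc b) (g := Fin.elim0)
            (key (θ := ω₁.curryLeft a) _ rfl ha₁) (key (θ := ω₁.curryLeft b) _ rfl hb₁)
            (key (θ := (ω₀.curryLeft a).curryLeft b) _ rfl hb)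
        rw [key2 a ha₁ hb, key2 a' ha'₁ hb']
      | succ m =>
        obtain ⟨b, hb₁, hb'₁, hb₀, hb'₀⟩ := Submodule.exists_notMem_four hr hr'
          (AlternatingMap.ker_curryLeft_ne_top ha₁) (AlternatingMap.ker_curryLeft_ne_top ha'₁)
          (AlternatingMap.ker_curryLeft_sup_span_ne_top ha₀)
          (AlternatingMap.ker_curryLeft_sup_span_ne_top ha'₀)
        rw [hZ.scalar_eq_of_contract_ne_zero i e ω₀ ω₁ (hloc a) (hloc b) hb₁ hb₀,
          hZ.scalar_eq_of_contract_ne_zero i e ω₀ ω₁ (hloc a') (hloc b) hb'₁ hb'₀]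
    -- non-generic vectors impose no condition on the scalar
    have hdeg : ∀ a, (ω₀.curryLeft a = 0 ∨ ω₁.curryLeft a = 0) → ∀ d : F, d ≠ 0 →
        ∀ x g, Z (Matrix.vecCons (e + i x) (i ∘ Matrix.vecCons a g)) ↔
          ω₀ (Matrix.vecCons x (Matrix.vecCons a g)) + d * ω₁ (Matrix.vecCons a g) = 0 := by
      intro a ha d hd x g
      rw [hloc a x g]
      rcases ha with ha | ha
      · have h2 : ω₀ (Matrix.vecCons x (Matrix.vecCons a g)) = 0 := by
          rw [ω₀.map_vecCons_vecCons_comm, neg_eq_zero]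
          exact AlternatingMap.congr_fun ha (Matrix.vecCons x g)
        rw [h2, zero_add, zero_add, mul_eq_zero_iff_left (hc a), mul_eq_zero_iff_left hd]
      · have h2 : ω₁ (Matrix.vecCons a g) = 0 := AlternatingMap.congr_fun ha g
        rw [h2, mul_zero, mul_zero]
    obtain ⟨d, hd, hall⟩ : ∃ d : F, d ≠ 0 ∧ ∀ a, ω₀.curryLeft a ≠ 0 → ω₁.curryLeft a ≠ 0 →
        c a = d := by
      by_cases hex : ∃ a, ω₀.curryLeft a ≠ 0 ∧ ω₁.curryLeft a ≠ 0
      · obtain ⟨a, ha₀, ha₁⟩ := hex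
        exact ⟨c a, hc a, fun a' h h' => hconst a' a h h' ha₀ ha₁⟩
      · push Not at hex
        exact ⟨1, one_ne_zero, fun a h h' => absurd (hex a h) h'⟩
    refine ⟨d, hd, fun x g => ?_⟩
    have hg : g = Matrix.vecCons (g 0) (Matrix.vecTail g) := (Matrix.cons_head_tail g).symm
    rw [hg]
    by_cases h0 : ω₀.curryLeft (g 0) = 0
    · exact hdeg _ (Or.inl h0) d hd x _
    by_cases h1 : ω₁.curryLeft (g 0) = 0
    · exact hdeg _ (Or.inr h1) d hd x _
    · rw [← hall _ h0 h1]
      exact hloc _ x _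

end Gluing

/-! ### Slotwise hyperplanes are zero sets of alternating forms. -/

section Existence

variable {F V : Type*} [Field F] [AddCommGroup V] [Module F V]

/-- A slotwise hyperplane is unchanged when the first entry is used as a pivot. -/
theorem IsSlotwiseHyperplane.vecCons_pivot {k : ℕ} {Z : (Fin (k + 1) → V) → Prop}
    (hZ : IsSlotwiseHyperplane F Z) (v : Fin (k + 1) → V) {s : F} (hs : s ≠ 0) (t : Fin k → F) :
    Z (Matrix.vecCons (s • v 0) (fun j => v j.succ + t j • v 0)) ↔ Z v := by
  rw [← hZ.add_smul_iff v 0 (Matrix.vecCons 0 t) rfl]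
  obtain ⟨f, hf⟩ := hZ.slot_zero (fun j => v j.succ + t j • v 0)
  have h : (fun i => v i + (Matrix.vecCons 0 t : Fin (k + 1) → F) i • v 0) =
      Matrix.vecCons (v 0) (fun j => v j.succ + t j • v 0) := by
    funext i
    refine Fin.cases ?_ (fun j => ?_) i <;> simp
  rw [h, hf, hf, map_smul, smul_eq_zero_iff_right hs]

/-- Extension of an alternating form describing a slotwise hyperplane from a subspace `H` to the
subspace spanned by `H` and a further vector. -/
theorem IsSlotwiseHyperplane.exists_extension {k : ℕ} {Z : (Fin (k + 1) → V) → Prop}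
    (hZ : IsSlotwiseHyperplane F Z) {H : Submodule F V} {e : V} (he : e ∉ H)
    (ω₀ : V [⋀^Fin (k + 1)]→ₗ[F] F) (ω₁ : V [⋀^Fin k]→ₗ[F] F)
    (h₀ : ∀ v, (∀ j, v j ∈ H) → (Z v ↔ ω₀ v = 0))
    (h₁ : ∀ g, Z (Matrix.vecCons e g) ↔ ω₁ g = 0) :
    ∃ ω : V [⋀^Fin (k + 1)]→ₗ[F] F,
      ∀ v, (∀ j, v j ∈ H ⊔ Submodule.span F {e}) → (Z v ↔ ω v = 0) := by
  obtain ⟨c, -, hc⟩ := hZ.exists_gluing_scalar H.subtype e (ω₀.compLinearMap H.subtype)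
    (ω₁.compLinearMap H.subtype) (fun v => h₀ _ fun j => (v j).2) (fun g => h₁ _)
  obtain ⟨ε', hε', hH'⟩ := Submodule.exists_le_ker_of_notMem he
  set ε : V →ₗ[F] F := (ε' e)⁻¹ • ε' with hεdef
  have hεe : ε e = 1 := inv_mul_cancel₀ hε'
  have hεH : ∀ x ∈ H, ε x = 0 := by
    intro x hx
    have : ε' x = 0 := hH' hx
    simp [hεdef, this]
  set p : V →ₗ[F] V := LinearMap.id - ε.smulRight e with hp
  have hpH : ∀ x ∈ H, p x = x := by
    intro x hx
    simp [hp, hεH x hx]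
  have hpe : ∀ x ∈ H, p (e + x) = x := by
    intro x hx
    simp [hp, hεH x hx, hεe]
  have hmem : ∀ y ∈ H ⊔ Submodule.span F {e}, y - ε y • e ∈ H := by
    intro y hy
    obtain ⟨x, hx, z, hz, rfl⟩ := Submodule.mem_sup.1 hy
    obtain ⟨t, rfl⟩ := Submodule.mem_span_singleton.1 hz
    simpa [hεH x hx, hεe] using hx
  -- On H ⊕ Fe, p is the projection onto H along e. The second summand is c ε ∧ ω₁, written as a
  -- signed sum over the slot fed to ε.
  set ω : V [⋀^Fin (k + 1)]→ₗ[F] F := ω₀.compLinearMap p +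
    c • AlternatingMap.alternatizeUncurryFin (ε.smulRight ω₁) with hω
  have hωv : ∀ v, ω v = ω₀ (p ∘ v) +
      c * ∑ j : Fin (k + 1), (-1 : ℤ) ^ (j : ℕ) • (ε (v j) * ω₁ (j.removeNth v)) := by
    intro v
    simp only [hω, AlternatingMap.add_apply, AlternatingMap.smul_apply, smul_eq_mul,
      AlternatingMap.alternatizeUncurryFin_apply, LinearMap.smulRight_apply]
    rfl
  have hωZ := ω.isSlotwiseHyperplane
  -- the case of tuples in `H`
  have hin : ∀ v, (∀ j, v j ∈ H) → (Z v ↔ ω v = 0) := by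
    intro v hv
    have h2 : p ∘ v = v := funext fun j => hpH _ (hv j)
    rw [h₀ v hv, hωv, h2, Finset.sum_eq_zero, mul_zero, add_zero]
    intro j _
    rw [hεH _ (hv j), zero_mul, smul_zero]
  -- the case of tuples in `H`, except for a first entry in `e + H`
  have hcons : ∀ x g, x ∈ H → (∀ j, g j ∈ H) →
      (Z (Matrix.vecCons (e + x) g) ↔ ω (Matrix.vecCons (e + x) g) = 0) := by
    intro x g hx hg
    have h2 : p ∘ (Matrix.vecCons (e + x) g : Fin (k + 1) → V) = Matrix.vecCons x g := by
      rw [Function.comp_vecCons, hpe x hx]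
      congr 1
      exact funext fun j => hpH _ (hg j)
    have h3 : ∑ j : Fin (k + 1), (-1 : ℤ) ^ (j : ℕ) •
        (ε ((Matrix.vecCons (e + x) g : Fin (k + 1) → V) j) *
          ω₁ (j.removeNth (Matrix.vecCons (e + x) g : Fin (k + 1) → V))) = ω₁ g := by
      rw [Fin.sum_univ_succ, Finset.sum_eq_zero]
      · have h4 : (0 : Fin (k + 1)).removeNth (Matrix.vecCons (e + x) g : Fin (k + 1) → V) = g := by
          funext j
          simp [Fin.removeNth]
        simp [h4, hεe, hεH x hx]
      · intro j _
        rw [Matrix.cons_val_succ, hεH _ (hg j), zero_mul, smul_zero]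
    rw [hωv, h2, h3]
    have := hc ⟨x, hx⟩ (fun j => ⟨g j, hg j⟩)
    rw [AlternatingMap.compLinearMap_apply, AlternatingMap.compLinearMap_apply] at this
    have h4 : (fun j => H.subtype ((Matrix.vecCons (⟨x, hx⟩ : H) (fun j => ⟨g j, hg j⟩) :
        Fin (k + 1) → H) j)) = Matrix.vecCons x g :=
      Function.comp_vecCons H.subtype (⟨x, hx⟩ : H) (fun j => ⟨g j, hg j⟩)
    rw [h4] at this
    exact this
  have hfirst : ∀ v, (∀ j, v j ∈ H ⊔ Submodule.span F {e}) → ε (v 0) ≠ 0 →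
      (Z v ↔ ω v = 0) := by
    intro v hv hv0
    -- Pivoting on v 0 scales it into e + H and clears the e-components of the other entries;
    -- neither `Z` nor the vanishing of ω is affected.
    have hs := inv_ne_zero hv0
    rw [← hZ.vecCons_pivot v hs (fun j => - (ε (v j.succ) / ε (v 0))),
      ← hωZ.vecCons_pivot v hs (fun j => - (ε (v j.succ) / ε (v 0)))]
    have h5 : (ε (v 0))⁻¹ • v 0 = e + (ε (v 0))⁻¹ • (v 0 - ε (v 0) • e) := by
      rw [smul_sub, smul_smul, inv_mul_cancel₀ hv0, one_smul]; abel
    rw [h5]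
    refine hcons _ _ (H.smul_mem _ (hmem _ (hv 0))) fun j => ?_
    have h6 : v j.succ + -(ε (v j.succ) / ε (v 0)) • v 0 =
        (v j.succ - ε (v j.succ) • e) - (ε (v j.succ) / ε (v 0)) • (v 0 - ε (v 0) • e) := by
      rw [smul_sub, smul_smul, div_mul_cancel₀ _ hv0, neg_smul]; abel
    rw [h6]
    exact H.sub_mem (hmem _ (hv _)) (H.smul_mem _ (hmem _ (hv 0)))
  refine ⟨ω, fun v hv => ?_⟩
  by_cases hall : ∀ j, ε (v j) = 0
  · refine hin v fun j => ?_
    simpa [hall j] using hmem _ (hv j)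
  push Not at hall
  obtain ⟨j, hj⟩ := hall
  rw [← hZ.comp_swap v 0 j, ← hωZ.comp_swap v 0 j]
  exact hfirst _ (fun l => hv _) (by simpa using hj)

/-- Over a finite-dimensional vector space, each slotwise hyperplane is the zero set of an
alternating form. -/
theorem IsSlotwiseHyperplane.exists_alternatingMap [FiniteDimensional F V] :
    ∀ {k : ℕ} {Z : (Fin k → V) → Prop}, IsSlotwiseHyperplane F Z →
      ∃ ω : V [⋀^Fin k]→ₗ[F] F, ∀ v, Z v ↔ ω v = 0 := by
  classical
  intro k
  induction k with
  | zero =>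
    intro Z _
    by_cases h : Z Fin.elim0
    · refine ⟨0, fun v => ?_⟩
      simp [Subsingleton.elim v Fin.elim0, h]
    · refine ⟨AlternatingMap.constOfIsEmpty F V (Fin 0) 1, fun v => ?_⟩
      simp [Subsingleton.elim v Fin.elim0, h]
  | succ k ih =>
    intro Z hZ
    have key : ∀ s : Finset V, ∃ ω : V [⋀^Fin (k + 1)]→ₗ[F] F,
        ∀ v, (∀ j, v j ∈ Submodule.span F (s : Set V)) → (Z v ↔ ω v = 0) := by
      intro s
      induction s using Finset.induction_on with
      | empty =>
        refine ⟨0, fun v hv => ?_⟩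
        obtain ⟨f, hf⟩ := hZ.slot v 0
        have hv0 : v 0 = 0 := by simpa using hv 0
        have := hf (v 0)
        rw [Function.update_eq_self, hv0, map_zero] at this
        simpa using this
      | insert e s _ ihs =>
        obtain ⟨ω₀, hω₀⟩ := ihs
        rw [Finset.coe_insert, Submodule.span_insert, sup_comm]
        by_cases he : e ∈ Submodule.span F (s : Set V)
        · rw [sup_eq_left.2 ((Submodule.span_singleton_le_iff_mem _ _).2 he)]
          exact ⟨ω₀, hω₀⟩
        -- The induction on the degree supplies ω₁ on all of V, the induction on the spanning set
        -- supplies ω₀.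
        · obtain ⟨ω₁, hω₁⟩ := ih (hZ.contract e)
          exact hZ.exists_extension he ω₀ ω₁ hω₀ hω₁
    obtain ⟨s, hs⟩ := (Module.Finite.fg_top : (⊤ : Submodule F V).FG)
    obtain ⟨ω, hω⟩ := key s
    exact ⟨ω, fun v => hω v fun j => by rw [hs]; trivial⟩

end Existence

/-! ### Dimension and incidence of subspaces. -/

section Flats

variable {F V : Type*} [Field F] [AddCommGroup V] [Module F V]

theorem Submodule.exists_ge_finrank_eq [FiniteDimensional F V] (U : Submodule F V) {d : ℕ}
    (hd : Module.finrank F U ≤ d) (hd' : d ≤ Module.finrank F V) :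
    ∃ W, U ≤ W ∧ Module.finrank F W = d := by
  induction d, hd using Nat.le_induction with
  | base => exact ⟨U, le_rfl, rfl⟩
  | succ d _ ih =>
    obtain ⟨W, hUW, hW⟩ := ih (by omega)
    have hne : W ≠ ⊤ := by
      rintro rfl
      rw [finrank_top] at hW
      omega
    obtain ⟨x, hx, -⟩ := Submodule.exists_notMem_notMem hne hne
    exact ⟨W ⊔ Submodule.span F {x}, hUW.trans le_sup_left, by
      rw [Submodule.finrank_sup_span_singleton hx, hW]⟩

/-- The exchange property for subspaces. -/
theorem Submodule.mem_sup_span_singleton_exchange {U : Submodule F V} {x y : V}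
    (h : x ∈ U ⊔ Submodule.span F {y}) (hx : x ∉ U) : y ∈ U ⊔ Submodule.span F {x} := by
  obtain ⟨u, hu, z, hz, hxu⟩ := Submodule.mem_sup.1 h
  obtain ⟨t, rfl⟩ := Submodule.mem_span_singleton.1 hz
  have ht : t ≠ 0 := by
    rintro rfl
    exact hx (by simpa [← hxu] using hu)
  have h1 : y = -(t⁻¹ • u) + t⁻¹ • x := by
    rw [← hxu, smul_add, smul_smul, inv_mul_cancel₀ ht, one_smul]; abel
  rw [h1]
  exact Submodule.add_mem_sup (U.neg_mem (U.smul_mem _ hu))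
    (Submodule.smul_mem _ _ (Submodule.mem_span_singleton_self _))

theorem Projectivization.submodule_le_iff_rep_mem (P : ℙ F V) (X : Submodule F V) :
    P.submodule ≤ X ↔ P.rep ∈ X := by
  rw [Projectivization.submodule_eq, Submodule.span_singleton_le_iff_mem]

/-- A subspace `X` not containing the line `L` meets it in at most one point. -/
theorem Projectivization.eq_of_mem_line [FiniteDimensional F V] {P Q : ℙ F V}
    {L X : Submodule F V} (hL : Module.finrank F L = 2) (hP : P.submodule ≤ L)
    (hQ : Q.submodule ≤ L) (hPX : P.submodule ≤ X) (hQX : Q.submodule ≤ X) (hLX : ¬ L ≤ X) :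
    P = Q := by
  have h1 : Module.finrank F ↥(L ⊓ X) < 2 := by
    rw [← hL]
    exact Submodule.finrank_lt_finrank_of_lt
      (lt_of_le_of_ne inf_le_left fun h => hLX (inf_eq_left.1 h))
  have key : ∀ R : ℙ F V, R.submodule ≤ L → R.submodule ≤ X → R.submodule = L ⊓ X :=
    fun R hR hRX => Submodule.eq_of_le_of_finrank_le (le_inf hR hRX) (by
      rw [Projectivization.finrank_submodule]; omega)
  exact Projectivization.submodule_injective ((key P hP hPX).trans (key Q hQ hQX).symm)

end Flats

/-! ### The complex defined by a linear mapping. -/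

section LinearMapping

variable {F : Type*} [Field F] {n h : ℕ}

theorem ProjFlat.exists_ge (hn : h + 2 ≤ n) (X : ProjFlat F n h) :
    ∃ V : ProjFlat F n (h + 1), X.1 ≤ V.1 := by
  obtain ⟨W, hXW, hW⟩ := X.1.exists_ge_finrank_eq (d := h + 1 + 1) (by rw [X.2]; omega)
    (by rw [Module.finrank_fin_fun]; omega)
  exact ⟨⟨W, hW⟩, hXW⟩

/-- Each nonzero vector of a flat is avoided by some hyperplane of that flat. -/
theorem ProjFlat.exists_le_notMem (V : ProjFlat F n (h + 1)) {q : Vec F n} (hq : q ∈ V.1)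
    (hq0 : q ≠ 0) : ∃ X : ProjFlat F n h, X.1 ≤ V.1 ∧ q ∉ X.1 := by
  have hq' : (⟨q, hq⟩ : V.1) ∉ (⊥ : Submodule F V.1) := by simpa using hq0
  obtain ⟨g, hgq, -⟩ := Submodule.exists_le_ker_of_notMem hq'
  have hg0 : g ≠ 0 := by
    rintro rfl
    exact hgq rfl
  have hk : Module.finrank F (LinearMap.ker g) = h + 1 := by
    have := g.finrank_range_add_finrank_ker
    rw [LinearMap.range_eq_top.2 (LinearMap.surjective hg0), finrank_top, Module.finrank_self,
      V.2] at this
    omega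
  refine ⟨⟨(LinearMap.ker g).map V.1.subtype, by rw [Submodule.finrank_map_subtype_eq, hk]⟩,
    Submodule.map_subtype_le _ _, ?_⟩
  rintro ⟨y, hy, hyq⟩
  have : y = ⟨q, hq⟩ := Subtype.ext hyq
  exact hgq (by rw [← this]; exact hy)

theorem ProjFlat.inf_eq {X : ProjFlat F n h} {V₁ V₂ : ProjFlat F n (h + 1)} (h₁ : X.1 ≤ V₁.1)
    (h₂ : X.1 ≤ V₂.1) (hne : V₁ ≠ V₂) : V₁.1 ⊓ V₂.1 = X.1 := by
  refine (Submodule.eq_of_le_of_finrank_le (le_inf h₁ h₂) ?_).symm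
  have hlt : V₁.1 ⊓ V₂.1 < V₁.1 := lt_of_le_of_ne inf_le_left fun heq =>
    hne (Subtype.ext (Submodule.eq_of_le_of_finrank_le (inf_eq_left.1 heq)
      (by rw [V₁.2, V₂.2])))
  have := Submodule.finrank_lt_finrank_of_lt hlt
  rw [V₁.2] at this
  rw [X.2]
  omega

/-- Each pencil contains at least three elements. -/
theorem ProjFlat.exists_third {X : ProjFlat F n h} {V₁ V₂ : ProjFlat F n (h + 1)}
    (h₁ : X.1 ≤ V₁.1) (h₂ : X.1 ≤ V₂.1) (hne : V₁ ≠ V₂) :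
    ∃ V₃ : ProjFlat F n (h + 1), X.1 ≤ V₃.1 ∧ V₃.1 ≤ V₁.1 ⊔ V₂.1 ∧ V₃ ≠ V₁ ∧ V₃ ≠ V₂ := by
  have hinf := ProjFlat.inf_eq h₁ h₂ hne
  have key : ∀ V : ProjFlat F n (h + 1), ∃ a ∈ V.1, a ∉ X.1 := by
    intro V
    by_contra! hc
    have := Submodule.finrank_mono (R := F) (show V.1 ≤ X.1 from hc)
    rw [V.2, X.2] at this
    omega
  obtain ⟨a, ha, haX⟩ := key V₁
  obtain ⟨b, hb, hbX⟩ := key V₂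
  have hb₁ : b ∉ V₁.1 := fun hb₁ => hbX (hinf ▸ ⟨hb₁, hb⟩)
  have ha₂ : a ∉ V₂.1 := fun ha₂ => haX (hinf ▸ ⟨ha, ha₂⟩)
  have hab₁ : a + b ∉ V₁.1 := fun hab => hb₁ ((V₁.1.add_mem_iff_right ha).1 hab)
  have hab₂ : a + b ∉ V₂.1 := fun hab => ha₂ ((V₂.1.add_mem_iff_left hb).1 hab)
  have hmem : a + b ∈ X.1 ⊔ Submodule.span F {a + b} :=
    Submodule.mem_sup_right (Submodule.mem_span_singleton_self _)
  refine ⟨⟨X.1 ⊔ Submodule.span F {a + b}, by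
    rw [Submodule.finrank_sup_span_singleton fun hab => hab₁ (h₁ hab), X.2]⟩, le_sup_left,
    sup_le (h₁.trans le_sup_left) ?_, ?_, ?_⟩
  · rw [Submodule.span_singleton_le_iff_mem]
    exact Submodule.add_mem_sup ha hb
  · intro heq
    exact hab₁ (congrArg Subtype.val heq ▸ hmem)
  · intro heq
    exact hab₂ (congrArg Subtype.val heq ▸ hmem)

variable {χ : ProjFlat F n (h + 1) →. PG n F}

/-- If the image of one flat through `X` does not lie on `X`, then all flats through `X` belong to
the domain, and their images do not lie on `X`. -/
theorem IsLinearMapping.exists_image_not_le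
    (hlin : IsLinearMapping (pencils F n (h + 1)) (projLines F n) χ)
    (hnull : ∀ V : ProjFlat F n (h + 1), ∀ P ∈ χ V, P.submodule ≤ V.1)
    {X : ProjFlat F n h} {V₁ V₂ : ProjFlat F n (h + 1)} (h₁ : X.1 ≤ V₁.1) (h₂ : X.1 ≤ V₂.1)
    {P₁ : PG n F} (hP₁ : P₁ ∈ χ V₁) (hP₁X : ¬ P₁.submodule ≤ X.1) :
    ∃ P₂ ∈ χ V₂, ¬ P₂.submodule ≤ X.1 := by
  by_cases hne : V₁ = V₂
  · subst hne
    exact ⟨P₁, hP₁, hP₁X⟩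
  have hinf := ProjFlat.inf_eq h₁ h₂ hne
  obtain ⟨V₃, h₃, h₃', h₃₁, h₃₂⟩ := ProjFlat.exists_third h₁ h₂ hne
  set l : Set (ProjFlat F n (h + 1)) := {Y | X.1 ≤ Y.1 ∧ Y.1 ≤ V₁.1 ⊔ V₂.1} with hl
  have hlB : l ∈ pencils F n (h + 1) := by
    refine ⟨X.1, V₁.1 ⊔ V₂.1, h₁.trans le_sup_left, X.2, ?_, rfl⟩
    have := Submodule.finrank_sup_add_finrank_inf_eq V₁.1 V₂.1
    rw [hinf, V₁.2, V₂.2, X.2] at this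
    omega
  have hV₁ : V₁ ∈ l := ⟨h₁, le_sup_left⟩
  have hV₂ : V₂ ∈ l := ⟨h₂, le_sup_right⟩
  have hV₃ : V₃ ∈ l := ⟨h₃, h₃'⟩
  have hdom : ∀ {Y P}, P ∈ χ Y → Y ∈ χ.Dom := fun {Y P} hP => (PFun.mem_dom χ Y).2 ⟨P, hP⟩
  rcases hlin l hlB with ⟨himage, hsub, hinj⟩ | ⟨⟨Q, hQ⟩, hex⟩ | hsub
  · obtain ⟨P₂, hP₂⟩ := (PFun.mem_dom χ V₂).1 (hsub hV₂)
    -- If P₂ were on X, the image line L would join two distinct points of V₁ and so lie in V₁. Then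
    -- P₃ ∈ V₁ ∩ V₃ = X, whence P₃ = L ∩ X = P₂, against injectivity.
    refine ⟨P₂, hP₂, fun hP₂X => ?_⟩
    obtain ⟨P₃, hP₃⟩ := (PFun.mem_dom χ V₃).1 (hsub hV₃)
    obtain ⟨L, hL⟩ := himage
    have hmem : ∀ Y ∈ l, ∀ P ∈ χ Y, P.submodule ≤ L.1 := by
      intro Y hY P hP
      have h4 : P ∈ χ.image l := ⟨Y, hY, hP⟩
      rw [hL] at h4
      exact h4
    have hL₁ := hmem _ hV₁ _ hP₁
    have hL₂ := hmem _ hV₂ _ hP₂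
    have hL₃ := hmem _ hV₃ _ hP₃
    have hLV : L.1 ≤ V₁.1 := by
      by_contra hLV
      have := Projectivization.eq_of_mem_line L.2 hL₁ hL₂ (hnull _ _ hP₁) (hP₂X.trans h₁) hLV
      exact hP₁X (this ▸ hP₂X)
    have hP₃X : P₃.submodule ≤ X.1 := by
      rw [← ProjFlat.inf_eq h₁ h₃ (Ne.symm h₃₁)]
      exact le_inf (hL₃.trans hLV) (hnull _ _ hP₃)
    have h5 : P₃ = P₂ := Projectivization.eq_of_mem_line L.2 hL₃ hL₂ hP₃X hP₂X
      fun hLX => hP₁X (hL₁.trans hLX)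
    exact h₃₂ (hinj _ hV₃ _ hV₂ P₃ hP₃ (h5 ▸ hP₂))
  -- At least two flats of the pencil have the image Q, which therefore lies on their intersection
  -- X.
  · exfalso
    have hQmem : ∀ Y ∈ l, ∀ P ∈ χ Y, P = Q := by
      intro Y hY P hP
      have h4 : P ∈ χ.image l := ⟨Y, hY, hP⟩
      rw [hQ] at h4
      exact h4
    have hP₁Q := hQmem _ hV₁ _ hP₁
    obtain ⟨Y, hYl, hYne, P, hP⟩ : ∃ Y ∈ l, Y ≠ V₁ ∧ ∃ P, P ∈ χ Y := by
      by_cases h₂d : V₂ ∈ χ.Dom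
      · exact ⟨V₂, hV₂, Ne.symm hne, (PFun.mem_dom χ V₂).1 h₂d⟩
      · refine ⟨V₃, hV₃, h₃₁, (PFun.mem_dom χ V₃).1 ?_⟩
        by_contra h₃d
        exact h₃₂ (hex.unique ⟨hV₃, h₃d⟩ ⟨hV₂, h₂d⟩)
    have hPP : P = P₁ := (hQmem _ hYl _ hP).trans hP₁Q.symm
    apply hP₁X
    rw [← ProjFlat.inf_eq h₁ hYl.1 (Ne.symm hYne)]
    exact le_inf (hnull _ _ hP₁) (hPP ▸ hnull _ _ hP)
  · exact absurd (hdom hP₁) (hsub hV₁)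

/-- The set of all flats `X` such that the images of all flats through `X` lie on `X`. -/
def flatsThroughImages (χ : ProjFlat F n (h + 1) →. PG n F) : Set (ProjFlat F n h) :=
  {X | ∀ V : ProjFlat F n (h + 1), X.1 ≤ V.1 → ∀ P ∈ χ V, P.submodule ≤ X.1}

/-- One flat through X decides for all. In particular X belongs to the set as soon as some flat
through X is exceptional. -/
theorem IsLinearMapping.mem_flatsThroughImages_iff
    (hlin : IsLinearMapping (pencils F n (h + 1)) (projLines F n) χ)
    (hnull : ∀ V : ProjFlat F n (h + 1), ∀ P ∈ χ V, P.submodule ≤ V.1)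
    {X : ProjFlat F n h} {V : ProjFlat F n (h + 1)} (hXV : X.1 ≤ V.1) :
    X ∈ flatsThroughImages χ ↔ ∀ P ∈ χ V, P.submodule ≤ X.1 := by
  refine ⟨fun hX => hX V hXV, fun hX V' hXV' P hP => ?_⟩
  by_contra hc
  obtain ⟨P₂, hP₂, hP₂X⟩ := hlin.exists_image_not_le hnull hXV' hXV hP hc
  exact hP₂X (hX P₂ hP₂)

/-- A set of `h`-subspaces such that the members of it in each `(h + 1)`-subspace are those
through some vector (the zero vector if the subspace is total). -/
def HasPoleVectors (K : Set (ProjFlat F n h)) : Prop :=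
  ∀ V : ProjFlat F n (h + 1), ∃ p ∈ V.1, ∀ X : ProjFlat F n h, X.1 ≤ V.1 → (X ∈ K ↔ p ∈ X.1)

theorem IsLinearMapping.hasPoleVectors
    (hlin : IsLinearMapping (pencils F n (h + 1)) (projLines F n) χ)
    (hnull : ∀ V : ProjFlat F n (h + 1), ∀ P ∈ χ V, P.submodule ≤ V.1) :
    HasPoleVectors (flatsThroughImages χ) := by
  intro V
  by_cases hV : ∃ P, P ∈ χ V
  · obtain ⟨P, hP⟩ := hV
    refine ⟨P.rep, (P.submodule_le_iff_rep_mem _).1 (hnull V P hP), fun X hX => ?_⟩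
    rw [hlin.mem_flatsThroughImages_iff hnull hX, ← P.submodule_le_iff_rep_mem]
    exact ⟨fun h => h P hP, fun h Q hQ => Part.mem_unique hP hQ ▸ h⟩
  · refine ⟨0, V.1.zero_mem, fun X hX => ?_⟩
    rw [hlin.mem_flatsThroughImages_iff hnull hX]
    exact ⟨fun _ => X.1.zero_mem, fun _ P hP => absurd ⟨P, hP⟩ hV⟩

theorem Fin.span_range_update {V : Type*} [AddCommGroup V] [Module F V] {k : ℕ}
    (v : Fin (k + 1) → V) (i : Fin (k + 1)) (x : V) :
    Submodule.span F (Set.range (Function.update v i x)) =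
      Submodule.span F (Set.range fun j => v (i.succAbove j)) ⊔ Submodule.span F {x} := by
  rw [sup_comm, ← Submodule.span_insert]
  congr 1
  ext y
  simp only [Set.mem_range, Set.mem_insert_iff, i.exists_iff_succAbove, Function.update_self,
    Function.update_of_ne (Fin.succAbove_ne i _), eq_comm (a := y)]

/-- The tuples of vectors that are dependent or span a member of `K`. -/
def IsTupleIn (K : Set (ProjFlat F n h)) (v : Fin (h + 1) → Vec F n) : Prop :=
  ∀ X : ProjFlat F n h, X.1 = Submodule.span F (Set.range v) → X ∈ K

/-- Let U be the span of the fixed entries, of vector dimension h. Inside an (h + 1)-subspace W ⊇ U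
with pole vector p, the admissible entries form U + Fp, or all of W if p ∈ U. Any two vectors lie in
a common W, so the admissible entries form a subspace of codimension at most one. -/
theorem HasPoleVectors.isSlotwiseHyperplane {K : Set (ProjFlat F n h)} (hK : HasPoleVectors K)
    (hn : h + 2 ≤ n) : IsSlotwiseHyperplane F (IsTupleIn K) where
  slot v i := by
    set U := Submodule.span F (Set.range fun j => v (i.succAbove j)) with hU
    have hUle : Module.finrank F U ≤ h := by
      simpa [Set.finrank] using finrank_range_le_card (R := F) (fun j => v (i.succAbove j))
    have hZ : ∀ x, IsTupleIn K (Function.update v i x) ↔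
        ∀ X : ProjFlat F n h, X.1 = U ⊔ Submodule.span F {x} → X ∈ K := by
      intro x
      rw [IsTupleIn, Fin.span_range_update]
    simp_rw [hZ]
    rcases hUle.lt_or_eq with hlt | heq
    -- Too few independent entries: no flat is spanned and the predicate holds vacuously.
    · refine ⟨0, fun x => iff_of_true (fun X hX => ?_) rfl⟩
      exfalso
      have h1 := Submodule.finrank_add_le_finrank_add_finrank U (Submodule.span F {x})
      have h2 : Module.finrank F (Submodule.span F {x}) ≤ 1 := by
        simpa using finrank_span_le_card (R := F) ({x} : Set (Vec F n))
      rw [← hX, X.2] at h1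
      omega
    have hUX : ∀ x ∈ U, ∀ X : ProjFlat F n h, X.1 ≠ U ⊔ Submodule.span F {x} := by
      intro x hx X hX
      rw [sup_eq_left.2 ((Submodule.span_singleton_le_iff_mem _ _).2 hx)] at hX
      have := X.2
      rw [hX, heq] at this
      omega
    have hflat : ∀ x ∉ U, ∃ X : ProjFlat F n h, X.1 = U ⊔ Submodule.span F {x} := fun x hx =>
      ⟨⟨_, by rw [Submodule.finrank_sup_span_singleton hx, heq]⟩, rfl⟩
    -- the local structure in an `(h + 1)`-subspace containing two given vectors
    have hloc : ∀ x y : Vec F n, ∃ W T : Submodule F (Vec F n), x ∈ W ∧ y ∈ W ∧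
        (∀ z ∈ W, (∀ X : ProjFlat F n h, X.1 = U ⊔ Submodule.span F {z} → X ∈ K) ↔ z ∈ T) ∧
        (∀ z ∈ W, z ∉ T → ∀ w ∈ W, ∃ r : F, w - r • z ∈ T) := by
      intro x y
      have hfr : Module.finrank F ↥(U ⊔ Submodule.span F {x} ⊔ Submodule.span F {y}) ≤
          h + 1 + 1 := by
        have h1 := Submodule.finrank_add_le_finrank_add_finrank U (Submodule.span F {x})
        have h2 := Submodule.finrank_add_le_finrank_add_finrank (U ⊔ Submodule.span F {x})
          (Submodule.span F {y})
        have h3 : ∀ x : Vec F n, Module.finrank F (Submodule.span F {x}) ≤ 1 := fun x => by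
          simpa using finrank_span_le_card (R := F) ({x} : Set (Vec F n))
        have := h3 x
        have := h3 y
        omega
      obtain ⟨W, hUW, hW⟩ := Submodule.exists_ge_finrank_eq _ hfr
        (by rw [Module.finrank_fin_fun]; omega)
      have hU' : U ≤ W := le_sup_left.trans (le_sup_left.trans hUW)
      obtain ⟨p, hp, hpK⟩ := hK ⟨W, hW⟩
      have hxW : x ∈ W := hUW (Submodule.mem_sup_left
        (Submodule.mem_sup_right (Submodule.mem_span_singleton_self x)))
      have hyW : y ∈ W := hUW (Submodule.mem_sup_right (Submodule.mem_span_singleton_self y))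
      have hXW : ∀ z ∈ W, U ⊔ Submodule.span F {z} ≤ W := fun z hz =>
        sup_le hU' ((Submodule.span_singleton_le_iff_mem _ _).2 hz)
      by_cases hpU : p ∈ U
      · refine ⟨W, ⊤, hxW, hyW, fun z hz => iff_of_true (fun X hX => ?_) trivial,
          fun z _ hz => absurd trivial hz⟩
        rw [hpK X (hX ▸ hXW z hz), hX]
        exact Submodule.mem_sup_left hpU
      · refine ⟨W, U ⊔ Submodule.span F {p}, hxW, hyW, fun z hz => ?_, fun z hz hzT w hw => ?_⟩
        -- For z ∉ U, exchange turns p ∈ U + Fz into z ∈ U + Fp; for z ∈ U no flat is spanned.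
        · by_cases hzU : z ∈ U
          · exact iff_of_true (fun X hX => absurd hX (hUX z hzU X)) (Submodule.mem_sup_left hzU)
          · constructor
            · intro hall
              obtain ⟨X, hX⟩ := hflat z hzU
              have h1 := (hpK X (hX ▸ hXW z hz)).1 (hall X hX)
              rw [hX] at h1
              exact Submodule.mem_sup_span_singleton_exchange h1 hpU
            · intro hzT X hX
              rw [hpK X (hX ▸ hXW z hz), hX]
              exact Submodule.mem_sup_span_singleton_exchange hzT hzU
        · have htop : U ⊔ Submodule.span F {p} ⊔ Submodule.span F {z} = W :=
            Submodule.eq_of_le_of_finrank_le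
              (sup_le (hXW p hp) ((Submodule.span_singleton_le_iff_mem _ _).2 hz)) (by
                rw [Submodule.finrank_sup_span_singleton hzT,
                  Submodule.finrank_sup_span_singleton hpU, hW, heq])
          rw [← htop] at hw
          obtain ⟨t, ht, s, hs, rfl⟩ := Submodule.mem_sup.1 hw
          obtain ⟨r, rfl⟩ := Submodule.mem_span_singleton.1 hs
          exact ⟨r, by simpa using ht⟩
    let S : Submodule F (Vec F n) :=
      { carrier := {z | ∀ X : ProjFlat F n h, X.1 = U ⊔ Submodule.span F {z} → X ∈ K}
        zero_mem' := by
          obtain ⟨W, T, -, -, hT, -⟩ := hloc 0 0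
          exact (hT 0 W.zero_mem).2 T.zero_mem
        add_mem' := by
          intro x y hx hy
          obtain ⟨W, T, hxW, hyW, hT, -⟩ := hloc x y
          exact (hT _ (W.add_mem hxW hyW)).2 (T.add_mem ((hT x hxW).1 hx) ((hT y hyW).1 hy))
        smul_mem' := by
          intro c x hx
          obtain ⟨W, T, hxW, -, hT, -⟩ := hloc x x
          exact (hT _ (W.smul_mem c hxW)).2 (T.smul_mem c ((hT x hxW).1 hx)) }
    refine S.exists_dual_mem_iff fun x y hy => ?_
    obtain ⟨W, T, hxW, hyW, hT, hr⟩ := hloc x y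
    obtain ⟨r, hr⟩ := hr y hyW (fun h => hy ((hT y hyW).2 h)) x hxW
    exact ⟨r, (hT _ (W.sub_mem hxW (W.smul_mem r hyW))).2 hr⟩
  alt v i j hij hv X hX := by
    exfalso
    have hli : LinearIndependent F v := by
      rw [linearIndependent_iff_card_eq_finrank_span, Set.finrank, ← hX, X.2, Fintype.card_fin]
    exact hij (hli.injective hv)

/-- A proper set of `h`-subspaces with pole vectors is a linear complex. -/
theorem HasPoleVectors.isLinearComplex {K : Set (ProjFlat F n h)} (hK : HasPoleVectors K)
    (hn : h + 2 ≤ n) (hne : K ≠ Set.univ) : IsLinearComplex K := by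
  obtain ⟨ω, hω⟩ := (hK.isSlotwiseHyperplane hn).exists_alternatingMap
  set f := exteriorPower.alternatingMapLinearEquiv ω with hf
  have hmem : ∀ X : ProjFlat F n h, X ∈ K ↔ plucker X ∈ (LinearMap.ker f).projectivization := by
    intro X
    set b := Module.finBasisOfFinrankEq F X.1 X.2
    have hspan : Submodule.span F (Set.range fun i => (b i : Vec F n)) = X.1 := by
      have h1 : (fun i => (b i : Vec F n)) = X.1.subtype ∘ b := rfl
      rw [h1, Set.range_comp, ← Submodule.map_span, b.span_eq, Submodule.map_top,
        Submodule.range_subtype]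
    rw [Submodule.mem_projectivization_iff_submodule_le, plucker, Projectivization.submodule_mk,
      Submodule.span_singleton_le_iff_mem, LinearMap.mem_ker, hf,
      exteriorPower.alternatingMapLinearEquiv_apply_ιMulti, ← hω, IsTupleIn, hspan]
    exact ⟨fun hX Y hY => Subtype.ext hY ▸ hX, fun hX => hX X rfl⟩
  -- Only here is `K` required to be proper: otherwise the kernel need not be a hyperplane.
  have hf0 : f ≠ 0 := by
    intro h0
    refine hne (Set.eq_univ_of_forall fun X => ?_)
    rw [hmem, Submodule.mem_projectivization_iff_submodule_le, h0, LinearMap.ker_zero]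
    exact le_top
  refine ⟨(LinearMap.ker f).projectivization, ?_, Set.ext hmem⟩
  exact (OrderIso.isCoatom_iff Projectivization.Subspace.submodule.symm _).2
    (LinearMap.isCoatom_ker_of_surjective (LinearMap.surjective hf0))

/-! ### Recovering a complex from its dual polarity; the main theorem. -/

theorem mem_dualPolarity_iff (K : LinearComplex F n h) (V : ProjFlat F n (h + 1)) (P : PG n F) :
    P ∈ dualPolarity K V ↔ ¬ IsTotalFlat K.1 V ∧ IsPole K.1 V P := by
  constructor
  · rintro ⟨hV, rfl⟩
    exact ⟨hV, (existsUnique_pole K.2 V hV).choose_spec.1⟩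
  · rintro ⟨hV, hP⟩
    exact ⟨hV, (existsUnique_pole K.2 V hV).unique
      (existsUnique_pole K.2 V hV).choose_spec.1 hP⟩

/-- Membership in a linear complex can be read off from the dual polarity. -/
theorem LinearComplex.mem_iff (K : LinearComplex F n h) {X : ProjFlat F n h}
    {V : ProjFlat F n (h + 1)} (hXV : X.1 ≤ V.1) :
    X ∈ K.1 ↔ ∀ P ∈ dualPolarity K V, P.submodule ≤ X.1 := by
  constructor
  · intro hX P hP
    exact (((mem_dualPolarity_iff K V P).1 hP).2.2 X hXV).1 hX
  · intro hX
    by_cases hV : IsTotalFlat K.1 V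
    · exact hV X hXV
    · obtain ⟨P, hP, -⟩ := existsUnique_pole K.2 V hV
      exact (hP.2 X hXV).2 (hX P ((mem_dualPolarity_iff K V P).2 ⟨hV, hP⟩))

theorem dualPolarity_injective (hn : h + 2 ≤ n) :
    Function.Injective (dualPolarity : LinearComplex F n h → _) := by
  intro K K' hKK
  refine Subtype.ext (Set.ext fun X => ?_)
  obtain ⟨V, hXV⟩ := X.exists_ge hn
  rw [K.mem_iff hXV, K'.mem_iff hXV, hKK]

end LinearMapping

theorem mainTheorem12 {F : Type*} [Field F] (n h : ℕ) (hn : h + 2 ≤ n)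
    (χ : ProjFlat F n (h + 1) →. PG n F)
    (hlin : IsLinearMapping (pencils F n (h + 1)) (projLines F n) χ)
    (hdom : χ.Dom.Nonempty)
    (hnull : ∀ V : ProjFlat F n (h + 1), ∀ P ∈ χ V, P.submodule ≤ V.1) :
    ∃! K : LinearComplex F n h, dualPolarity K = χ := by
  -- A hyperplane of V that misses V^χ is not in the complex.
  have hnot : ∀ V, ∀ P ∈ χ V, ¬ IsTotalFlat (flatsThroughImages χ) V := by
    intro V P hP htot
    obtain ⟨X, hXV, hX⟩ := V.exists_le_notMem
      ((P.submodule_le_iff_rep_mem _).1 (hnull V P hP)) P.rep_nonzero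
    exact hX ((P.submodule_le_iff_rep_mem _).1 (htot X hXV V hXV P hP))
  have hpole : ∀ V, ∀ P ∈ χ V, IsPole (flatsThroughImages χ) V P := by
    refine fun V P hP => ⟨hnull V P hP, fun X hXV => ?_⟩
    rw [hlin.mem_flatsThroughImages_iff hnull hXV]
    exact ⟨fun hX => hX P hP, fun hX Q hQ => Part.mem_unique hP hQ ▸ hX⟩
  have hK : IsLinearComplex (flatsThroughImages χ) := by
    refine (hlin.hasPoleVectors hnull).isLinearComplex hn fun huniv => ?_
    obtain ⟨V, hV⟩ := hdom
    obtain ⟨P, hP⟩ := (PFun.mem_dom χ V).1 hV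
    exact hnot V P hP fun X _ => huniv ▸ Set.mem_univ X
  have hχ : dualPolarity ⟨flatsThroughImages χ, hK⟩ = χ := by
    refine PFun.ext fun V P => ?_
    rw [mem_dualPolarity_iff]
    refine ⟨fun ⟨hV, hP⟩ => ?_, fun hP => ⟨hnot V P hP, hpole V P hP⟩⟩
    -- An exceptional V is total, since the condition on its `h`-subspaces is vacuous.
    obtain ⟨Q, hQ⟩ : ∃ Q, Q ∈ χ V := by
      by_contra hc
      refine hV fun X hXV => ?_
      rw [hlin.mem_flatsThroughImages_iff hnull hXV]
      exact fun Q hQ => absurd ⟨Q, hQ⟩ hc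
    rwa [(existsUnique_pole hK V hV).unique hP (hpole V Q hQ)]
  exact ⟨_, hχ, fun K' hK' => dualPolarity_injective hn (hK'.trans hχ.symm)⟩
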